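/- **Setting.** Let $\psi_1\equiv1$, $\psi_{2k}(t)=\sqrt2\cos(2\pi kt)$, $\psi_{2k+1}(t)=\sqrt2\sin(2\pi kt)$ ($k\ge1$) be the trigonometric basis of $L^2[0,1]$. For $r\in\mathbb R$ put $w^r_1=1$, $w^r_{2k}=w^r_{2k+1}=k^{2r}$, $\|f\|_{w^r}^2=\sum_{j\ge1}w^r_j\langle f,\psi_j\rangle^2$, and $\mathcal W_p^\rho=\{f\in L^2[0,1]:\|f\|_{w^p}^2\le\rho\}$. Fix $\sigma,\rho>0$, $d,\eta\ge1$, a real $p$ and an integer $s$ with $0\le s\le p$, and a positive weight sequence $(\upsilon_j)_{j\ge1}$. Let $X$ be a centered random element of $L^2[0,1]$ with $\mathbb E\|X\|^2<\infty$ and covariance operator $T$, $Tf=\mathbb E[\langle X,f\rangle X]$. Assume that $X$ is second order stationary, i.e. $T$ is the integral operator with kernel $c(t-u)$, $t,u\in[0,1]$, for a measurable $1$-periodic (even) positive definite function $c$; or, more generally, that $T\psi_j=\lambda_j\psi_j$ for all $j\ge 1$. Here $\lambda_j=\langle T\psi_j,\psi_j\rangle$, and we assume $1/d\le\lambda_j/\upsilon_j\le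 d$ for all $j\ge1$. Let $\varepsilon$ be an error term with mean $0$ and variance $1$ that is uncorrelated with $X$, and assume for some integer $k\ge4$ that $\sup_j\mathbb E|\langle X,\psi_j\rangle/\sqrt{\lambda_j}|^{4k}\le\eta$ and $\mathbb E|\varepsilon|^{4k}\le\eta$. Given independent copies $(X_i,\varepsilon_i)$, $1\le i\le n$, of $(X,\varepsilon)$, one observes $(Y_i,X_i)$ with $Y_i=\langle\beta,X_i\rangle+\sigma\varepsilon_i$. With $\hat g_j=\frac1n\sum_iY_i\langle X_i,\psi_j\rangle$ and $\hat\lambda_j=\frac1n\sum_i\langle X_i,\psi_j\rangle^2$, the orthogonal series estimator with dimension $m=m(n)$ and threshold $\alpha=\alpha(n)$ is $$\hat\beta=\sum_{j=1}^m\frac{\hat g_j}{\hat\lambda_j}\mathbf 1\{\hat\lambda_j\ge\alpha\}\,\psi_j .$$ Write $a_n\lesssim b_n$ if $a_n\le Cb_n$ for some $C>0$ and all sufficiently large $n$, and $a_n\sim b_n$ if $a_n\lesssim b_n\lesssim a_n$. **Proposition.** Every $f$ with $\|f\|_{w^p}<\infty$, and every realization of $\hat\beta$, has a unique $s$-th weak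 derivative in $L^2[0,1]$. Moreover: (i) *Polynomial case.* Let $\upsilon_1=1$, $\upsilon_j=j^{-2a}$ ($j\ge2$) with $a>1/2$. If $m\sim n^{1/(2p+2a+1)}$ and $\alpha\sim1/n$, then $$\sup_{\beta\in\mathcal W_p^\rho}\mathbb E\|\hat\beta^{(s)}-\beta^{(s)}\|^2\lesssim n^{-(2p-2s)/(2p+2a+1)} .$$ (ii) *Exponential case.* Let $\upsilon_1=1$, $\upsilon_j=\exp(-j^{2a})$ ($j\ge2$) with $a>0$. There are dimensions $m\sim(\log n)^{1/(2a)}$ such that, for some $\Delta\ge1$ and all large $n$, $$\frac{w^p_m}{n\,w^s_m}\sum_{j=1}^m\frac{w^s_j}{\upsilon_j}\le\Delta ,$$ and for all such $m$ and all $\alpha\sim1/n$, $$\sup_{\beta\in\mathcal W_p^\rho}\mathbb E\|\hat\beta^{(s)}-\beta^{(s)}\|^2\lesssim(\log n)^{-(p-s)/a} .$$ In both cases the constant in $\lesssim$, and the sample size from which on the bound holds, can be chosen independently of the joint law of $(X,\varepsilon)$, subject to the assumptions above with the given $\upsilon,d,\eta$, and independently of $k$. -/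

import Mathlib

open MeasureTheory ProbabilityTheory Filter
open scoped ENNReal

universe u

noncomputable section

/-! ### The space `L²[0,1]` and the trigonometric basis -/

/-- Lebesgue measure on `[0,1]`. -/
abbrev unitMeasure : Measure ℝ := volume.restrict (Set.Icc (0 : ℝ) 1)

/-- The real Hilbert space `L²[0,1]`. -/
abbrev L2I : Type := Lp ℝ 2 unitMeasure

/-- `L²[0,1]` carries its Borel σ-algebra. -/
instance : MeasurableSpace L2I := borel L2I

instance : BorelSpace L2I := ⟨rfl⟩

/-- The trigonometric functions, indexed by `j ≥ 1`: the constant `1` for `j = 1`,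
`√2 cos (2πkt)` for `j = 2k` and `√2 sin (2πkt)` for `j = 2k + 1`, `k ≥ 1`
(the value at `j = 0` is never used). -/
def trigFun (j : ℕ) (t : ℝ) : ℝ :=
  if j = 1 then 1
  else if Even j then √2 * Real.cos (2 * Real.pi * ((j / 2 : ℕ) : ℝ) * t)
  else √2 * Real.sin (2 * Real.pi * ((j / 2 : ℕ) : ℝ) * t)

theorem trigFun_memLp (j : ℕ) : MemLp (trigFun j) 2 unitMeasure := by
  have hc : Continuous (trigFun j) := by
    unfold trigFun
    split_ifs <;> fun_prop
  have hb : ∀ t, ‖trigFun j t‖ ≤ 1 + √2 := by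
    intro t
    have h2 : (0 : ℝ) ≤ √2 := Real.sqrt_nonneg 2
    unfold trigFun
    split_ifs
    · simp
    · rw [norm_mul, Real.norm_eq_abs, Real.norm_eq_abs, abs_of_nonneg h2]
      nlinarith [Real.abs_cos_le_one (2 * Real.pi * ((j / 2 : ℕ) : ℝ) * t)]
    · rw [norm_mul, Real.norm_eq_abs, Real.norm_eq_abs, abs_of_nonneg h2]
      nlinarith [Real.abs_sin_le_one (2 * Real.pi * ((j / 2 : ℕ) : ℝ) * t)]
  exact MemLp.of_bound hc.aestronglyMeasurable (1 + √2) (Eventually.of_forall hb)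

/-- The element `ψ_j` of `L²[0,1]`, `j ≥ 1`. -/
def trig (j : ℕ) : L2I := (trigFun_memLp j).toLp (trigFun j)

/-! ### Sobolev ellipsoids and weak derivatives -/

/-- The weights `w_1^r = 1` and `w_{2k}^r = w_{2k+1}^r = k^{2r}`, `k ≥ 1`. -/
def sobolevWeight (r : ℝ) (j : ℕ) : ℝ :=
  if j = 1 then 1 else ((j / 2 : ℕ) : ℝ) ^ (2 * r)

/-- `‖f‖²_{w^r} = ∑_{j ≥ 1} w_j^r ⟨f, ψ_j⟩²`, with values in `[0,∞]`. -/
def sobolevNormSq (r : ℝ) (f : L2I) : ℝ≥0∞ :=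
  ∑' j : ℕ, ENNReal.ofReal (sobolevWeight r (j + 1) * (inner ℝ f (trig (j + 1))) ^ 2)

/-- The ellipsoid `W_p^ρ` in the Sobolev space of periodic functions. -/
def sobolevEllipsoid (p ρ : ℝ) : Set L2I :=
  {f | sobolevNormSq p f ≤ ENNReal.ofReal ρ}

/-- `g` is an `s`-th weak derivative of `f` on `(0,1)`. -/
def IsWeakDeriv (s : ℕ) (f g : L2I) : Prop :=
  ∀ φ : ℝ → ℝ, ContDiff ℝ ((⊤ : ℕ∞) : WithTop ℕ∞) φ → HasCompactSupport φ → tsupport φ ⊆ Set.Ioo 0 1 →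
    ∫ t in Set.Icc (0 : ℝ) 1, f t * iteratedDeriv s φ t =
      (-1) ^ s * ∫ t in Set.Icc (0 : ℝ) 1, g t * φ t

open Classical in
/-- The `s`-th weak derivative `f^{(s)} ∈ L²[0,1]` of `f` (with value `0` if there is none). -/
def weakDeriv (s : ℕ) (f : L2I) : L2I :=
  if h : ∃ g, IsWeakDeriv s f g then h.choose else 0

/-! ### Regressor, error term and sample -/

section Model

variable {Ω : Type u} [MeasurableSpace Ω] (P : Measure Ω)

/-- The covariance operator `f ↦ E[⟨X, f⟩ X]` of a centred random element `X` of `L²[0,1]`. -/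
def covOp (X : Ω → L2I) (f : L2I) : L2I :=
  ∫ ω, (inner ℝ (X ω) f : ℝ) • X ω ∂P

/-- `λ_j = ⟨T ψ_j, ψ_j⟩`, where `T` is the covariance operator; this is the eigenvalue
that belongs to `ψ_j` whenever `ψ_j` is an eigenvector of `T`. -/
def trigEigenvalue (X : Ω → L2I) (j : ℕ) : ℝ :=
  inner ℝ (covOp P X (trig j)) (trig j)

/-- Second order stationarity (on the circle `ℝ/ℤ`) of a centred random function:
`Cov (X(t), X(s)) = c (t - s)` for a 1-periodic positive definite function `c`,
i.e. the covariance operator is the integral operator on `[0,1]` with kernel `c (t - s)`. -/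
def IsSecondOrderStationary (X : Ω → L2I) : Prop :=
  ∃ c : ℝ → ℝ, Measurable c ∧ Function.Periodic c 1 ∧ (∀ t, c (-t) = c t) ∧
    (∀ (N : ℕ) (t : Fin N → ℝ) (b : Fin N → ℝ),
      0 ≤ ∑ i, ∑ k, b i * b k * c (t i - t k)) ∧
    ∀ f : L2I, (covOp P X f : ℝ → ℝ) =ᵐ[unitMeasure]
      fun s => ∫ t in Set.Icc (0 : ℝ) 1, c (t - s) * f t

/-- The trigonometric functions are eigenfunctions of the covariance operator. -/
def IsTrigDiagonal (X : Ω → L2I) : Prop :=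
  ∀ j : ℕ, 1 ≤ j → covOp P X (trig j) = trigEigenvalue P X j • trig j

/-- `X` is a centred random element of `L²[0,1]` with `E‖X‖² < ∞` which is second order
stationary or, more generally, has a covariance operator that is diagonal in the trigonometric
basis; its eigenvalues satisfy the link condition `1/d ≤ λ_j/υ_j ≤ d`, and the `r`-th absolute
moments of the standardized coefficients `⟨X, ψ_j⟩/√λ_j` are bounded by `η`. -/
structure IsRegressor (υ : ℕ → ℝ) (d η : ℝ) (r : ℕ) (X : Ω → L2I) : Prop where
  measurable : Measurable X
  memLp : MemLp X 2 P
  centered : ∫ ω, X ω ∂P = 0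
  spectral : IsSecondOrderStationary P X ∨ IsTrigDiagonal P X
  link : ∀ j : ℕ, 1 ≤ j →
    1 / d ≤ trigEigenvalue P X j / υ j ∧ trigEigenvalue P X j / υ j ≤ d
  moment : ∀ j : ℕ, 1 ≤ j →
    ∫⁻ ω, ENNReal.ofReal (|inner ℝ (X ω) (trig j) / √(trigEigenvalue P X j)| ^ r) ∂P
      ≤ ENNReal.ofReal η

/-- `ε` is centred with variance one, and its `r`-th absolute moment is bounded by `η`. -/
structure IsErrorTerm (η : ℝ) (r : ℕ) (ε : Ω → ℝ) : Prop where
  measurable : Measurable ε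
  centered : ∫ ω, ε ω ∂P = 0
  variance_one : ∫ ω, ε ω ^ 2 ∂P = 1
  moment : ∫⁻ ω, ENNReal.ofReal (|ε ω| ^ r) ∂P ≤ ENNReal.ofReal η

/-- `(Xs i, εs i)`, `i < n`, are independent copies of `(X, ε)`, where `X` and `ε` are
uncorrelated. -/
structure IsSample {n : ℕ} (X : Ω → L2I) (ε : Ω → ℝ)
    (Xs : Fin n → Ω → L2I) (εs : Fin n → Ω → ℝ) : Prop where
  uncorrelated : ∀ f : L2I, ∫ ω, ε ω * inner ℝ (X ω) f ∂P = 0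
  indep : iIndepFun (fun i ω => (Xs i ω, εs i ω)) P
  identDistrib : ∀ i,
    IdentDistrib (fun ω => (Xs i ω, εs i ω)) (fun ω => (X ω, ε ω)) P P

end Model

/-! ### The orthogonal series estimator -/

/-- `ĝ_j = n⁻¹ ∑ᵢ Yᵢ ⟨Xᵢ, ψ_j⟩`. -/
def gHat {n : ℕ} (x : Fin n → L2I) (y : Fin n → ℝ) (j : ℕ) : ℝ :=
  (1 / (n : ℝ)) * ∑ i, y i * inner ℝ (x i) (trig j)

/-- `λ̂_j = n⁻¹ ∑ᵢ ⟨Xᵢ, ψ_j⟩²`. -/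
def lambdaHat {n : ℕ} (x : Fin n → L2I) (j : ℕ) : ℝ :=
  (1 / (n : ℝ)) * ∑ i, (inner ℝ (x i) (trig j) : ℝ) ^ 2

open Classical in
/-- The estimator `β̂ = ∑_{j=1}^m (ĝ_j/λ̂_j) 1{λ̂_j ≥ α} ψ_j`. -/
def seriesEstimator {n : ℕ} (m : ℕ) (α : ℝ) (x : Fin n → L2I) (y : Fin n → ℝ) : L2I :=
  ∑ j ∈ Finset.Icc 1 m, (if α ≤ lambdaHat x j then gHat x y j / lambdaHat x j else 0) • trig j

/-- The risk `E‖β̂^{(s)} - β^{(s)}‖²` in `[0,∞]`, when the estimator is computed from the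
observations `(Yᵢ, Xᵢ)` with `Yᵢ = ∫₀¹ β(t) Xᵢ(t) dt + σ εᵢ`. -/
def derivRisk {Ω : Type u} [MeasurableSpace Ω] (P : Measure Ω) {n : ℕ}
    (Xs : Fin n → Ω → L2I) (εs : Fin n → Ω → ℝ) (σ : ℝ) (s m : ℕ) (α : ℝ) (β : L2I) : ℝ≥0∞ :=
  ∫⁻ ω, ‖weakDeriv s (seriesEstimator m α (fun i => Xs i ω)
      (fun i => inner ℝ β (Xs i ω) + σ * εs i ω)) - weakDeriv s β‖ₑ ^ 2 ∂P

/-! ### Rates -/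

/-- `a_n ≲ b_n`. -/
def RateLE (a b : ℕ → ℝ) : Prop := ∃ C : ℝ, 0 < C ∧ ∀ᶠ n in atTop, a n ≤ C * b n

/-- `a_n ∼ b_n`. -/
def RateEq (a b : ℕ → ℝ) : Prop := RateLE a b ∧ RateLE b a

/-- The polynomial weights `υ_1 = 1`, `υ_j = j^{-2a}` for `j ≥ 2`. -/
def polyWeight (a : ℝ) (j : ℕ) : ℝ := if j = 1 then 1 else (j : ℝ) ^ (-2 * a)

/-- The exponential weights `υ_1 = 1`, `υ_j = exp (-j^{2a})` for `j ≥ 2`. -/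
def expWeight (a : ℝ) (j : ℕ) : ℝ := if j = 1 then 1 else Real.exp (-(j : ℝ) ^ (2 * a))

/-- `sup_{β ∈ W_p^ρ} E‖β̂^{(s)} - β^{(s)}‖² ≲ rate n`, for the estimator with dimension `m n` and
threshold `α n`. The constant and the sample size from which on the bound holds depend neither on
`β` nor on the law of `(X, ε)` within the class given by `υ`, `d`, `η`; moments of some order
`4k`, `k ≥ 4`, are required. -/
def HasUpperRate (υ : ℕ → ℝ) (p : ℝ) (s : ℕ) (ρ σ d η : ℝ) (m : ℕ → ℕ) (α : ℕ → ℝ)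
    (rate : ℕ → ℝ) : Prop :=
  ∃ C : ℝ, 0 < C ∧ ∃ N : ℕ, ∀ n : ℕ, N ≤ n →
    ∀ (Ω : Type u) [MeasurableSpace Ω] (P : Measure Ω) [IsProbabilityMeasure P]
      (k : ℕ) (X : Ω → L2I) (ε : Ω → ℝ) (Xs : Fin n → Ω → L2I) (εs : Fin n → Ω → ℝ),
      4 ≤ k → IsRegressor P υ d η (4 * k) X → IsErrorTerm P η (4 * k) ε →
      IsSample P X ε Xs εs →
      ⨆ β ∈ sobolevEllipsoid p ρ, derivRisk P Xs εs σ s (m n) (α n) β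
        ≤ ENNReal.ofReal (C * rate n)

/-- The upper half of the condition that determines the dimension parameter: for some `Δ ≥ 1` and
all large `n`, `w_m^p / (n w_m^s) ∑_{j ≤ m} w_j^s / υ_j ≤ Δ` with `m = m n`. -/
def VarianceBalanced (υ : ℕ → ℝ) (p : ℝ) (s : ℕ) (m : ℕ → ℕ) : Prop :=
  ∃ Δ : ℝ, 1 ≤ Δ ∧ ∀ᶠ n : ℕ in atTop,
    sobolevWeight p (m n) / ((n : ℝ) * sobolevWeight s (m n)) *
      ∑ j ∈ Finset.Icc 1 (m n), sobolevWeight s j / υ j ≤ Δ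

end

/-!
The proof compares coefficients. Since the trigonometric functions form a Hilbert basis of `L²[0,1]`
(`eq_zero_of_inner_trig_eq_zero`, from Parseval's identity for complex Fourier series) and
differentiation only exchanges `ψ_{2k}` and `ψ_{2k+1}` with a factor `± 2πk`, every `f` with
`‖f‖_{w^s} < ∞` has an `s`-th weak derivative, of squared norm at most `(2π)^{2s} ‖f‖²_{w^s}`
(`exists_isWeakDeriv`). Hence the risk is at most
`(2π)^{2s} ∑_j w_j^s E (β̂_j - β_j)²`.

For a stationary regressor the addition theorems make the covariance operator diagonal in the
trigonometric basis (`IsSecondOrderStationary.isTrigDiagonal`). Put `z = ⟨X, ψ_j⟩ / √λ_j` and let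
`u = ⟨β, X⟩ - β_j ⟨X, ψ_j⟩ + σ ε` be the part of the response that is uncorrelated with `z`; write
`L` and `D` for the averages of `z²` and `u z` over the sample. Then `λ̂_j = λ_j L` and
`ĝ_j - β_j λ̂_j = √λ_j D`, so that the squared error of the `j`-th coefficient is at most
`4 D² / λ_j`, plus `λ_j D² / α²` on the event `L < 1/2`, plus `β_j²` on the event `λ̂_j < α`
(`sq_coefficient_error_le`). The moment conditions give `E D² = O(1/n)`. Since `L` is an average of
nonnegative variables, Chernoff's bound with second moments already gives `P(L < 1/2) ≤ exp (-cn)`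
(`measure_average_lt_half_le`), which outweighs the factor `α⁻² ∼ n²`; in particular eighth moments
of `z` and `u` suffice, and the order `4k` of the moments does not enter the constants.

Let `R = w_m^s / w_m^p`. If `m` is balanced, `∑_{j ≤ m} w_j^s / υ_j ≤ Δ n R`, the variance terms sum
to `O(R)`. The event `λ̂_j < α` is exponentially unlikely if `λ_j ≥ 2α`; otherwise
`n υ_j` is bounded and the balance condition yields `w_j^s = O(R)`. The coefficients beyond `m`
contribute at most `R ρ`. So the risk is `O(R)` (`exists_iSup_derivRisk_le`), and `R` has the
claimed order because `R ≤ (m / 3)^{-2(p-s)}`. The dimensions of the polynomial case are balanced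
(`varianceBalanced_polyWeight`), and in the exponential case `m = ⌊(log n / 2)^{1/(2a)}⌋` is
(`exists_varianceBalanced_expWeight`).
-/

/-! ### The trigonometric basis of `L²[0,1]` -/

theorem trigFun_one (t : ℝ) : trigFun 1 t = 1 := by simp [trigFun]

theorem trigFun_even (k : ℕ) (t : ℝ) :
    trigFun (2 * k) t = √2 * Real.cos (2 * Real.pi * k * t) := by
  have h1 : 2 * k ≠ 1 := by omega
  simp [trigFun, h1]

theorem trigFun_odd {k : ℕ} (hk : 1 ≤ k) (t : ℝ) :
    trigFun (2 * k + 1) t = √2 * Real.sin (2 * Real.pi * k * t) := by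
  have h1 : k ≠ 0 := by omega
  have h2 : (2 * k + 1) / 2 = k := by omega
  simp [trigFun, h1, h2]

theorem eq_one_or_even_or_odd {j : ℕ} (hj : 1 ≤ j) :
    j = 1 ∨ (∃ k, 1 ≤ k ∧ j = 2 * k) ∨ ∃ k, 1 ≤ k ∧ j = 2 * k + 1 := by
  rcases Nat.even_or_odd' j with ⟨k, h | h⟩
  · exact Or.inr (Or.inl ⟨k, by omega, h⟩)
  · rcases Nat.eq_zero_or_pos k with h0 | h0
    · exact Or.inl (by omega)
    · exact Or.inr (Or.inr ⟨k, h0, h⟩)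

theorem continuous_trigFun (j : ℕ) : Continuous (trigFun j) := by
  unfold trigFun
  split_ifs <;> fun_prop

theorem memLp_unitMeasure_of_continuous {g : ℝ → ℝ} (hg : Continuous g) :
    MemLp g 2 unitMeasure := by
  obtain ⟨C, hC⟩ := (isCompact_Icc (a := (0 : ℝ)) (b := 1)).exists_bound_of_continuousOn
    hg.continuousOn
  refine MemLp.of_bound hg.aestronglyMeasurable C ?_
  exact (ae_restrict_iff' measurableSet_Icc).2 (Eventually.of_forall hC)

theorem inner_toLp_right (f : L2I) {g : ℝ → ℝ} (hg : MemLp g 2 unitMeasure) :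
    (inner ℝ f (hg.toLp g) : ℝ) = ∫ t in Set.Icc (0 : ℝ) 1, f t * g t := by
  rw [L2.inner_def]
  refine integral_congr_ae ?_
  filter_upwards [hg.coeFn_toLp] with t ht
  simp [ht, mul_comm]

theorem inner_trig (f : L2I) (j : ℕ) :
    (inner ℝ f (trig j) : ℝ) = ∫ t in Set.Icc (0 : ℝ) 1, f t * trigFun j t :=
  inner_toLp_right f _

theorem inner_trig_trig (i j : ℕ) :
    (inner ℝ (trig i) (trig j) : ℝ) = ∫ t in (0 : ℝ)..1, trigFun i t * trigFun j t := by
  rw [inner_trig, intervalIntegral.integral_of_le zero_le_one, integral_Icc_eq_integral_Ioc]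
  refine integral_congr_ae ?_
  have h : (trig i : ℝ → ℝ) =ᵐ[volume.restrict (Set.Ioc 0 1)] trigFun i := by
    rw [restrict_Ioc_eq_restrict_Icc]
    exact (trigFun_memLp i).coeFn_toLp
  filter_upwards [h] with t ht
  rw [ht]

theorem integral_cos_two_pi (z : ℤ) :
    ∫ t in (0 : ℝ)..1, Real.cos (2 * Real.pi * z * t) = if z = 0 then 1 else 0 := by
  split_ifs with h
  · simp [h]
  · have hz : (2 * Real.pi * z : ℝ) ≠ 0 := by
      have : (z : ℝ) ≠ 0 := by exact_mod_cast h
      positivity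
    rw [intervalIntegral.integral_comp_mul_left (fun x => Real.cos x) hz, integral_cos]
    have : Real.sin (2 * Real.pi * z * 1) = 0 := by
      rw [show (2 * Real.pi * z * 1 : ℝ) = ((2 * z : ℤ) : ℝ) * Real.pi by push_cast; ring]
      exact Real.sin_int_mul_pi _
    rw [mul_one] at this
    simp [this]

theorem integral_sin_two_pi (z : ℤ) :
    ∫ t in (0 : ℝ)..1, Real.sin (2 * Real.pi * z * t) = 0 := by
  by_cases h : z = 0
  · simp [h]
  · have hz : (2 * Real.pi * z : ℝ) ≠ 0 := by
      have : (z : ℝ) ≠ 0 := by exact_mod_cast h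
      positivity
    rw [intervalIntegral.integral_comp_mul_left (fun x => Real.sin x) hz, integral_sin]
    have : Real.cos (2 * Real.pi * z * 1) = 1 := by
      rw [show (2 * Real.pi * z * 1 : ℝ) = (z : ℝ) * (2 * Real.pi) by ring]
      exact Real.cos_int_mul_two_pi _
    rw [mul_one] at this
    simp [this]

theorem integral_cos_mul_cos (k l : ℕ) :
    ∫ t in (0 : ℝ)..1, Real.cos (2 * Real.pi * k * t) * Real.cos (2 * Real.pi * l * t) =
      ((if ((k : ℤ) - l) = 0 then 1 else 0) + if ((k : ℤ) + l) = 0 then 1 else 0) / 2 := by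
  rw [← integral_cos_two_pi, ← integral_cos_two_pi, ← intervalIntegral.integral_add
    (by apply Continuous.intervalIntegrable; fun_prop)
    (by apply Continuous.intervalIntegrable; fun_prop), ← intervalIntegral.integral_div]
  congr 1; ext t
  have h1 := Real.cos_add (2 * Real.pi * k * t) (2 * Real.pi * l * t)
  have h2 := Real.cos_sub (2 * Real.pi * k * t) (2 * Real.pi * l * t)
  push_cast
  rw [show 2 * Real.pi * ((k : ℝ) - l) * t = 2 * Real.pi * k * t - 2 * Real.pi * l * t by ring,
    show 2 * Real.pi * ((k : ℝ) + l) * t = 2 * Real.pi * k * t + 2 * Real.pi * l * t by ring]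
  linarith

theorem integral_sin_mul_sin (k l : ℕ) :
    ∫ t in (0 : ℝ)..1, Real.sin (2 * Real.pi * k * t) * Real.sin (2 * Real.pi * l * t) =
      ((if ((k : ℤ) - l) = 0 then 1 else 0) - if ((k : ℤ) + l) = 0 then 1 else 0) / 2 := by
  rw [← integral_cos_two_pi, ← integral_cos_two_pi, ← intervalIntegral.integral_sub
    (by apply Continuous.intervalIntegrable; fun_prop)
    (by apply Continuous.intervalIntegrable; fun_prop), ← intervalIntegral.integral_div]
  congr 1; ext t
  have h1 := Real.cos_add (2 * Real.pi * k * t) (2 * Real.pi * l * t)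
  have h2 := Real.cos_sub (2 * Real.pi * k * t) (2 * Real.pi * l * t)
  push_cast
  rw [show 2 * Real.pi * ((k : ℝ) - l) * t = 2 * Real.pi * k * t - 2 * Real.pi * l * t by ring,
    show 2 * Real.pi * ((k : ℝ) + l) * t = 2 * Real.pi * k * t + 2 * Real.pi * l * t by ring]
  linarith

theorem integral_sin_mul_cos (k l : ℕ) :
    ∫ t in (0 : ℝ)..1, Real.sin (2 * Real.pi * k * t) * Real.cos (2 * Real.pi * l * t) = 0 := by
  have h : ((∫ t in (0 : ℝ)..1, Real.sin (2 * Real.pi * ((k - l : ℤ) : ℝ) * t)) +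
      ∫ t in (0 : ℝ)..1, Real.sin (2 * Real.pi * ((k + l : ℤ) : ℝ) * t)) / 2 = 0 := by
    rw [integral_sin_two_pi, integral_sin_two_pi]; simp
  refine Eq.trans ?_ h
  rw [← intervalIntegral.integral_add
    (by apply Continuous.intervalIntegrable; fun_prop)
    (by apply Continuous.intervalIntegrable; fun_prop), ← intervalIntegral.integral_div]
  congr 1; ext t
  have h1 := Real.sin_add (2 * Real.pi * k * t) (2 * Real.pi * l * t)
  have h2 := Real.sin_sub (2 * Real.pi * k * t) (2 * Real.pi * l * t)
  push_cast
  rw [show 2 * Real.pi * ((k : ℝ) - l) * t = 2 * Real.pi * k * t - 2 * Real.pi * l * t by ring,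
    show 2 * Real.pi * ((k : ℝ) + l) * t = 2 * Real.pi * k * t + 2 * Real.pi * l * t by ring]
  linarith

theorem inner_trig_of_one_le {i j : ℕ} (hi : 1 ≤ i) (hj : 1 ≤ j) :
    (inner ℝ (trig i) (trig j) : ℝ) = if i = j then 1 else 0 := by
  have h2 : √2 * √2 = (2 : ℝ) := Real.mul_self_sqrt zero_le_two
  have hcc : ∀ a b : ℝ, √2 * a * (√2 * b) = 2 * (a * b) := fun a b => by
    rw [show √2 * a * (√2 * b) = (√2 * √2) * (a * b) by ring, h2]
  rw [inner_trig_trig]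
  rcases eq_one_or_even_or_odd hi with rfl | ⟨k, hk, rfl⟩ | ⟨k, hk, rfl⟩ <;>
  rcases eq_one_or_even_or_odd hj with rfl | ⟨l, hl, rfl⟩ | ⟨l, hl, rfl⟩
  · simp [trigFun_one]
  · have := integral_cos_two_pi l
    simp only [trigFun_one, trigFun_even l, one_mul, intervalIntegral.integral_const_mul]
    simp only [Int.cast_natCast] at this
    rw [this, if_neg (by omega), if_neg (by omega), mul_zero]
  · have := integral_sin_two_pi l
    simp only [trigFun_one, trigFun_odd hl, one_mul, intervalIntegral.integral_const_mul]
    simp only [Int.cast_natCast] at this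
    rw [this, if_neg (by omega), mul_zero]
  · have := integral_cos_two_pi k
    simp only [trigFun_one, trigFun_even k, mul_one, intervalIntegral.integral_const_mul]
    simp only [Int.cast_natCast] at this
    rw [this, if_neg (by omega), if_neg (by omega), mul_zero]
  · simp only [trigFun_even k, trigFun_even l, hcc, intervalIntegral.integral_const_mul,
      integral_cos_mul_cos]
    rw [if_neg (c := (k : ℤ) + l = 0) (by omega)]
    split_ifs <;> first | omega | norm_num
  · simp only [trigFun_even k, trigFun_odd hl, hcc, intervalIntegral.integral_const_mul]
    simp only [mul_comm (Real.cos _) (Real.sin _), integral_sin_mul_cos]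
    rw [if_neg (by omega), mul_zero]
  · have := integral_sin_two_pi k
    simp only [trigFun_one, trigFun_odd hk, mul_one, intervalIntegral.integral_const_mul]
    simp only [Int.cast_natCast] at this
    rw [this, if_neg (by omega), mul_zero]
  · simp only [trigFun_even l, trigFun_odd hk, hcc, intervalIntegral.integral_const_mul,
      integral_sin_mul_cos]
    rw [if_neg (by omega), mul_zero]
  · simp only [trigFun_odd hk, trigFun_odd hl, hcc, intervalIntegral.integral_const_mul,
      integral_sin_mul_sin]
    rw [if_neg (c := (k : ℤ) + l = 0) (by omega)]
    split_ifs <;> first | omega | norm_num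

theorem orthonormal_trig : Orthonormal ℝ (fun i : ℕ => trig (i + 1)) := by
  rw [orthonormal_iff_ite]
  intro i j
  rw [inner_trig_of_one_le (by omega) (by omega)]
  simp

/-- Completeness of the trigonometric system. The cosine and sine coefficients are the real and
imaginary parts of the complex Fourier coefficients, so that this is Parseval's identity. -/
theorem eq_zero_of_inner_trig_eq_zero (f : L2I)
    (h : ∀ j, 1 ≤ j → (inner ℝ f (trig j) : ℝ) = 0) : f = 0 := by
  have hf : MemLp f 2 unitMeasure := Lp.memLp f
  have hF : MemLp (fun x => (f x : ℂ)) 2 (volume.restrict (Set.Ioc (0 : ℝ) 1)) := by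
    rw [restrict_Ioc_eq_restrict_Icc]; exact hf.ofReal
  have hint : ∀ g : ℝ → ℝ, Continuous g →
      Integrable (fun x => g x * f x) (volume.restrict (Set.Ioc (0 : ℝ) 1)) := by
    intro g hg
    rw [restrict_Ioc_eq_restrict_Icc]
    exact (memLp_unitMeasure_of_continuous hg).integrable_mul hf
  have hcos : ∀ k : ℕ, ∫ x in Set.Ioc (0 : ℝ) 1, Real.cos (2 * Real.pi * k * x) * f x = 0 := by
    intro k
    rcases Nat.eq_zero_or_pos k with rfl | hk
    · have := h 1 le_rfl
      rw [inner_trig, integral_Icc_eq_integral_Ioc] at this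
      simpa [trigFun_one] using this
    · have := h (2 * k) (by omega)
      rw [inner_trig, integral_Icc_eq_integral_Ioc] at this
      simp only [trigFun_even k, mul_left_comm _ (√2), integral_const_mul] at this
      simpa [mul_comm] using this
  have hsin : ∀ k : ℕ, ∫ x in Set.Ioc (0 : ℝ) 1, Real.sin (2 * Real.pi * k * x) * f x = 0 := by
    intro k
    rcases Nat.eq_zero_or_pos k with rfl | hk
    · simp
    · have := h (2 * k + 1) (by omega)
      rw [inner_trig, integral_Icc_eq_integral_Ioc] at this
      simp only [trigFun_odd hk, mul_left_comm _ (√2), integral_const_mul] at this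
      simpa [mul_comm] using this
  have hcosz : ∀ z : ℤ, ∫ x in Set.Ioc (0 : ℝ) 1, Real.cos (2 * Real.pi * z * x) * f x = 0 := by
    intro z
    obtain ⟨k, rfl | rfl⟩ := Int.eq_nat_or_neg z
    · simpa using hcos k
    · simpa using hcos k
  have hsinz : ∀ z : ℤ, ∫ x in Set.Ioc (0 : ℝ) 1, Real.sin (2 * Real.pi * z * x) * f x = 0 := by
    intro z
    obtain ⟨k, rfl | rfl⟩ := Int.eq_nat_or_neg z
    · simpa using hsin k
    · have := hsin k
      simp only [Int.cast_neg, Int.cast_natCast, mul_neg, neg_mul, Real.sin_neg,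
        integral_neg, this, neg_zero]
  have hcoef : ∀ z : ℤ, fourierCoeffOn (zero_lt_one (α := ℝ)) (fun x => (f x : ℂ)) z = 0 := by
    intro z
    rw [fourierCoeffOn_eq_integral, intervalIntegral.integral_of_le zero_le_one]
    have : ∀ x : ℝ, (fourier (-z) (x : AddCircle ((1 : ℝ) - 0)) : ℂ) • (f x : ℂ) =
        ((Real.cos (2 * Real.pi * (-z : ℤ) * x) * f x : ℝ) : ℂ) +
          ((Real.sin (2 * Real.pi * (-z : ℤ) * x) * f x : ℝ) : ℂ) * Complex.I := by
      intro x
      rw [fourier_coe_apply, show (2 * (Real.pi : ℂ) * Complex.I * ((-z : ℤ) : ℂ) * x /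
        ((1 - 0 : ℝ) : ℂ)) = ((2 * Real.pi * (-z : ℤ) * x : ℝ) : ℂ) * Complex.I by
          push_cast; ring, Complex.exp_mul_I, ← Complex.ofReal_cos, ← Complex.ofReal_sin,
          smul_eq_mul]
      push_cast; ring
    simp only [this]
    rw [integral_add, integral_mul_const, integral_complex_ofReal, integral_complex_ofReal,
      hcosz, hsinz]
    · simp
    · exact (hint _ (by fun_prop)).ofReal
    · exact (hint _ (by fun_prop)).ofReal.mul_const _
  have hs := hasSum_sq_fourierCoeffOn (zero_lt_one (α := ℝ)) hF
  simp only [hcoef, norm_zero, ne_eq, OfNat.ofNat_ne_zero, not_false_eq_true, zero_pow] at hs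
  have h0 := hs.unique hasSum_zero
  rw [intervalIntegral.integral_of_le zero_le_one, ← integral_Icc_eq_integral_Ioc] at h0
  have h1 : (inner ℝ f f : ℝ) = 0 := by
    rw [L2.inner_def]
    simpa [sq] using h0
  exact inner_self_eq_zero.1 h1

/-- The trigonometric Hilbert basis of `L²[0,1]`; its `i`-th element is `ψ_{i+1}`. -/
noncomputable def trigBasis : HilbertBasis ℕ ℝ L2I :=
  HilbertBasis.mkOfOrthogonalEqBot orthonormal_trig (by
    rw [Submodule.eq_bot_iff]
    intro f hf
    refine eq_zero_of_inner_trig_eq_zero f fun j hj => ?_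
    rw [real_inner_comm]
    refine hf _ (Submodule.subset_span ⟨j - 1, ?_⟩)
    simp only [Nat.sub_add_cancel hj])

theorem trigBasis_apply (i : ℕ) : trigBasis i = trig (i + 1) := by
  simp [trigBasis]

theorem hasSum_inner_trig_mul (f g : L2I) :
    HasSum (fun i => (inner ℝ f (trig (i + 1)) : ℝ) * inner ℝ g (trig (i + 1))) (inner ℝ f g) := by
  have := trigBasis.hasSum_inner_mul_inner f g
  simp only [trigBasis_apply] at this
  simpa only [real_inner_comm g] using this

theorem tsum_inner_trig_sq (f : L2I) :
    ∑' i, ENNReal.ofReal ((inner ℝ f (trig (i + 1)) : ℝ) ^ 2) = ENNReal.ofReal (‖f‖ ^ 2) := by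
  have h := hasSum_inner_trig_mul f f
  rw [← real_inner_self_eq_norm_sq, ← h.tsum_eq, ENNReal.ofReal_tsum_of_nonneg _ h.summable]
  · simp only [sq]
  · exact fun i => mul_self_nonneg _

/-! ### Weak derivatives of Fourier series -/

theorem sobolevWeight_one (r : ℝ) : sobolevWeight r 1 = 1 := by simp [sobolevWeight]

theorem sobolevWeight_pos (r : ℝ) {j : ℕ} (hj : 1 ≤ j) : 0 < sobolevWeight r j := by
  unfold sobolevWeight
  split_ifs with h
  · exact one_pos
  · have : 0 < j / 2 := by omega
    positivity

theorem sobolevWeight_mono_left {r r' : ℝ} (h : r ≤ r') {j : ℕ} (hj : 1 ≤ j) :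
    sobolevWeight r j ≤ sobolevWeight r' j := by
  unfold sobolevWeight
  split_ifs with h1
  · exact le_rfl
  · have : 1 ≤ j / 2 := by omega
    exact Real.rpow_le_rpow_of_exponent_le (by exact_mod_cast this) (by linarith)

theorem sobolevWeight_zero {j : ℕ} : sobolevWeight 0 j = 1 := by
  simp [sobolevWeight]

theorem one_le_sobolevWeight {r : ℝ} (hr : 0 ≤ r) {j : ℕ} (hj : 1 ≤ j) :
    1 ≤ sobolevWeight r j := by
  rw [← sobolevWeight_zero (j := j)]
  exact sobolevWeight_mono_left hr hj

theorem sobolevNormSq_mono {r r' : ℝ} (h : r ≤ r') (f : L2I) :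
    sobolevNormSq r f ≤ sobolevNormSq r' f :=
  ENNReal.tsum_le_tsum fun i => ENNReal.ofReal_le_ofReal
    (mul_le_mul_of_nonneg_right (sobolevWeight_mono_left h (by omega)) (sq_nonneg _))

theorem sobolevNormSq_zero (f : L2I) : sobolevNormSq 0 f = ENNReal.ofReal (‖f‖ ^ 2) := by
  simp only [sobolevNormSq, sobolevWeight_zero, one_mul, tsum_inner_trig_sq]

theorem IsWeakDeriv.unique {s : ℕ} {f g h : L2I} (hg : IsWeakDeriv s f g)
    (hh : IsWeakDeriv s f h) : g = h := by
  rw [← sub_eq_zero]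
  have hint : ∀ u : L2I, ∀ φ : ℝ → ℝ, Continuous φ → Integrable (fun t => u t * φ t) unitMeasure :=
    fun u φ hφ => (Lp.memLp u).integrable_mul (memLp_unitMeasure_of_continuous hφ)
  have hsub := Lp.coeFn_sub g h
  have key : ∀ᵐ x ∂unitMeasure, x ∈ Set.Ioo (0 : ℝ) 1 → (g - h : L2I) x = 0 := by
    refine isOpen_Ioo.ae_eq_zero_of_integral_contDiff_smul_eq_zero ?_ ?_
    · exact ((Lp.memLp (g - h)).integrable (by norm_num)).integrableOn.locallyIntegrableOn
    · intro φ hφ hc hs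
      have h1 := (hg φ hφ hc hs).symm.trans (hh φ hφ hc hs)
      have h2 := mul_left_cancel₀ (pow_ne_zero s (by norm_num : (-1 : ℝ) ≠ 0)) h1
      have h3 : ∫ x, φ x • (g - h : L2I) x ∂unitMeasure =
          ∫ x, (g x * φ x - h x * φ x) ∂unitMeasure := by
        refine integral_congr_ae ?_
        filter_upwards [hsub] with x hx
        rw [hx]; simp only [Pi.sub_apply, smul_eq_mul]; ring
      rw [h3, integral_sub (hint _ _ hφ.continuous) (hint _ _ hφ.continuous), h2, sub_self]
  have hIoo : ∀ᵐ x ∂unitMeasure, x ∈ Set.Ioo (0 : ℝ) 1 := by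
    rw [unitMeasure, ← Measure.restrict_congr_set Ioo_ae_eq_Icc]
    exact ae_restrict_mem measurableSet_Ioo
  rw [Lp.eq_zero_iff_ae_eq_zero]
  filter_upwards [key, hIoo] with x hx hx'
  exact hx hx'

theorem weakDeriv_eq {s : ℕ} {f g : L2I} (h : IsWeakDeriv s f g) : weakDeriv s f = g := by
  have hex : ∃ g, IsWeakDeriv s f g := ⟨g, h⟩
  rw [weakDeriv, dif_pos hex]
  exact hex.choose_spec.unique h

theorem IsWeakDeriv.sub {s : ℕ} {f f' g g' : L2I} (h : IsWeakDeriv s f g)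
    (h' : IsWeakDeriv s f' g') : IsWeakDeriv s (f - f') (g - g') := by
  intro φ hφ hc hs
  have hsub : ∀ u v : L2I, ∀ χ : ℝ → ℝ, Continuous χ →
      ∫ t in Set.Icc (0 : ℝ) 1, (u - v : L2I) t * χ t =
        (∫ t in Set.Icc (0 : ℝ) 1, u t * χ t) - ∫ t in Set.Icc (0 : ℝ) 1, v t * χ t := by
    intro u v χ hχ
    have hm := memLp_unitMeasure_of_continuous hχ
    rw [← inner_toLp_right _ hm, ← inner_toLp_right _ hm, ← inner_toLp_right _ hm, inner_sub_left]
  rw [hsub _ _ _ (hφ.continuous_iteratedDeriv s (by exact_mod_cast le_top)),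
    hsub _ _ _ hφ.continuous, h φ hφ hc hs, h' φ hφ hc hs]
  ring

/-- Differentiation exchanges the cosine and the sine of equal frequency, i.e. `ψ_{2k}` and
`ψ_{2k+1}`. This is the corresponding involution of the indices `i = j - 1` (truncated subtraction
makes `0` a fixed point). -/
def trigSwap (i : ℕ) : ℕ := if i % 2 = 1 then i + 1 else i - 1

theorem trigSwap_involutive : Function.Involutive trigSwap := by
  intro i
  unfold trigSwap
  split_ifs <;> omega

/-- `trigSwap` as a permutation. -/
def trigSwapEquiv : ℕ ≃ ℕ := trigSwap_involutive.toPerm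

/-- The signed frequency `c_i` for which `ψ_{i+1}' = - c_i ψ_{τ i + 1}`, where `τ = trigSwap`. -/
noncomputable def trigFreq (i : ℕ) : ℝ :=
  if i % 2 = 1 then 2 * Real.pi * ((i + 1) / 2 : ℕ) else -(2 * Real.pi * ((i + 1) / 2 : ℕ))

theorem trigSwap_half (i : ℕ) : (trigSwap i + 1) / 2 = (i + 1) / 2 := by
  unfold trigSwap
  split_ifs <;> omega

theorem trigSwap_eq_zero {i : ℕ} : trigSwap i = 0 ↔ i = 0 := by
  unfold trigSwap
  by_cases h : i % 2 = 1
  · rw [if_pos h]; omega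
  · rw [if_neg h]; omega

theorem trigFreq_trigSwap (i : ℕ) : trigFreq (trigSwap i) = -trigFreq i := by
  rcases Nat.eq_zero_or_pos i with rfl | hi
  · simp [trigFreq, trigSwap]
  · unfold trigFreq
    rw [trigSwap_half]
    have : trigSwap i % 2 = 1 ↔ ¬ i % 2 = 1 := by
      unfold trigSwap
      by_cases h : i % 2 = 1
      · rw [if_pos h]; omega
      · rw [if_neg h]; omega
    by_cases h : i % 2 = 1
    · rw [if_pos h, if_neg (by rw [this]; simp [h])]
    · rw [if_neg h, if_pos (this.2 h), neg_neg]

theorem sobolevWeight_trigSwap (r : ℝ) (i : ℕ) :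
    sobolevWeight r (trigSwap i + 1) = sobolevWeight r (i + 1) := by
  have := trigSwap_eq_zero (i := i)
  by_cases h : i = 0
  · simp [sobolevWeight, h, trigSwap]
  · simp [sobolevWeight, this, h, trigSwap_half]

theorem sobolevWeight_mul_trigFreq_sq_le (r : ℝ) (i : ℕ) :
    sobolevWeight r (i + 1) * trigFreq i ^ 2 ≤
      (2 * Real.pi) ^ 2 * sobolevWeight (r + 1) (i + 1) := by
  rcases Nat.eq_zero_or_pos i with rfl | hi
  · simp [trigFreq, sobolevWeight]; positivity
  · have hk : 0 < (i + 1) / 2 := by omega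
    have h1 : i + 1 ≠ 1 := by omega
    have hsq : trigFreq i ^ 2 = (2 * Real.pi) ^ 2 * (((i + 1) / 2 : ℕ) : ℝ) ^ (2 : ℝ) := by
      rw [Real.rpow_two]
      unfold trigFreq
      split_ifs <;> ring
    rw [hsq, sobolevWeight, sobolevWeight, if_neg h1, if_neg h1, mul_left_comm, mul_add, mul_one,
      Real.rpow_add (by exact_mod_cast hk)]

theorem hasDerivAt_trigFun (i : ℕ) (t : ℝ) :
    HasDerivAt (trigFun (i + 1)) (-(trigFreq i * trigFun (trigSwap i + 1) t)) t := by
  rcases eq_one_or_even_or_odd (Nat.le_add_left 1 i) with h | ⟨k, hk, h⟩ | ⟨k, hk, h⟩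
  · obtain rfl : i = 0 := by omega
    have : trigFun (0 + 1) = fun _ => 1 := funext trigFun_one
    rw [this]
    simpa [trigFreq] using hasDerivAt_const t (1 : ℝ)
  · obtain rfl : i = 2 * k - 1 := by omega
    have h1 : (2 * k - 1) % 2 = 1 := by omega
    have h2 : 2 * k / 2 = k := by omega
    have hs : trigSwap (2 * k - 1) + 1 = 2 * k + 1 := by
      rw [trigSwap, if_pos h1]; omega
    have hf : trigFun (2 * k) = fun t => √2 * Real.cos (2 * Real.pi * k * t) :=
      funext (trigFun_even k)
    rw [hs, trigFreq, if_pos h1, h, trigFun_odd hk, hf, h2]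
    refine ((((hasDerivAt_id t).const_mul (2 * Real.pi * k)).cos).const_mul (√2)).congr_deriv ?_
    simp only [id]; ring
  · obtain rfl : i = 2 * k := by omega
    have h1 : ¬ (2 * k) % 2 = 1 := by omega
    have h2 : (2 * k + 1) / 2 = k := by omega
    have hs : trigSwap (2 * k) + 1 = 2 * k := by
      rw [trigSwap, if_neg h1]; omega
    have hf : trigFun (2 * k + 1) = fun t => √2 * Real.sin (2 * Real.pi * k * t) :=
      funext (trigFun_odd hk)
    rw [hs, trigFreq, if_neg h1, trigFun_even k, hf, h2]
    refine ((((hasDerivAt_id t).const_mul (2 * Real.pi * k)).sin).const_mul (√2)).congr_deriv ?_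
    simp only [id]; ring

/-- Integration by parts against a test function on `(0,1)`. -/
theorem integral_deriv_mul_trigFun {φ : ℝ → ℝ} (hφ : ContDiff ℝ 1 φ)
    (hs : tsupport φ ⊆ Set.Ioo 0 1) (i : ℕ) :
    ∫ t in Set.Icc (0 : ℝ) 1, deriv φ t * trigFun (i + 1) t =
      trigFreq i * ∫ t in Set.Icc (0 : ℝ) 1, φ t * trigFun (trigSwap i + 1) t := by
  have hz : ∀ x : ℝ, x ∉ Set.Ioo (0 : ℝ) 1 → φ x = 0 := fun x hx =>
    image_eq_zero_of_notMem_tsupport fun h => hx (hs h)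
  have hd : Continuous (deriv φ) := hφ.continuous_deriv le_rfl
  have key := intervalIntegral.integral_deriv_mul_eq_sub (a := 0) (b := 1)
    (u := φ) (v := trigFun (i + 1)) (u' := deriv φ)
    (v' := fun t => -(trigFreq i * trigFun (trigSwap i + 1) t))
    (fun x _ => (hφ.differentiable one_ne_zero x).hasDerivAt)
    (fun x _ => hasDerivAt_trigFun i x) (hd.intervalIntegrable _ _)
    (by apply Continuous.intervalIntegrable
        exact (continuous_const.mul (continuous_trigFun _)).neg)
  rw [hz 0 (by simp), hz 1 (by simp), intervalIntegral.integral_add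
    (by apply Continuous.intervalIntegrable; exact hd.mul (continuous_trigFun _))
    (by apply Continuous.intervalIntegrable
        exact hφ.continuous.mul (continuous_const.mul (continuous_trigFun _)).neg)] at key
  rw [integral_Icc_eq_integral_Ioc, integral_Icc_eq_integral_Ioc,
    ← intervalIntegral.integral_of_le zero_le_one, ← intervalIntegral.integral_of_le zero_le_one,
    ← intervalIntegral.integral_const_mul]
  have h2 : ∫ t in (0 : ℝ)..1, φ t * -(trigFreq i * trigFun (trigSwap i + 1) t) =
      -∫ t in (0 : ℝ)..1, trigFreq i * (φ t * trigFun (trigSwap i + 1) t) := by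
    rw [← intervalIntegral.integral_neg]
    congr 1; ext t; ring
  rw [h2] at key
  linarith

theorem isWeakDeriv_one_of_coeff {f g : L2I}
    (h : ∀ i, (inner ℝ g (trig (i + 1)) : ℝ) = trigFreq i * inner ℝ f (trig (trigSwap i + 1))) :
    IsWeakDeriv 1 f g := by
  intro φ hφ hc hs
  have hφ1 : ContDiff ℝ 1 φ := hφ.of_le (by exact_mod_cast le_top)
  have hd : Continuous (deriv φ) := hφ1.continuous_deriv le_rfl
  have hm := memLp_unitMeasure_of_continuous hφ.continuous
  have hm' := memLp_unitMeasure_of_continuous hd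
  rw [iteratedDeriv_one, pow_one, neg_one_mul, ← inner_toLp_right f hm', ← inner_toLp_right g hm]
  have hcoef : ∀ (χ : ℝ → ℝ) (hχ : MemLp χ 2 unitMeasure) (j : ℕ),
      (inner ℝ (hχ.toLp χ) (trig j) : ℝ) =
        ∫ t in Set.Icc (0 : ℝ) 1, χ t * trigFun j t := by
    intro χ hχ j
    rw [inner_trig]
    refine integral_congr_ae ?_
    filter_upwards [hχ.coeFn_toLp] with t ht
    rw [ht]
  have hrel : ∀ i, (inner ℝ (hm'.toLp (deriv φ)) (trig (i + 1)) : ℝ) =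
      trigFreq i * inner ℝ (hm.toLp φ) (trig (trigSwap i + 1)) := by
    intro i
    rw [hcoef, hcoef, integral_deriv_mul_trigFun hφ1 hs]
  have h1 := hasSum_inner_trig_mul f (hm'.toLp (deriv φ))
  have h2 := (hasSum_inner_trig_mul g (hm.toLp φ)).neg
  rw [← trigSwapEquiv.hasSum_iff] at h1
  refine h1.unique (h2.congr_fun ?_)
  intro i
  have hsw : trigSwapEquiv i = trigSwap i := rfl
  simp only [Function.comp_apply, hsw, hrel, trigSwap_involutive i, trigFreq_trigSwap, h i]
  ring

theorem tsupport_iteratedDeriv_subset (φ : ℝ → ℝ) (s : ℕ) :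
    tsupport (iteratedDeriv s φ) ⊆ tsupport φ := by
  induction s with
  | zero => simp
  | succ s ih =>
    rw [iteratedDeriv_succ]
    exact (tsupport_deriv_subset).trans ih

theorem IsWeakDeriv.succ {s : ℕ} {f g h : L2I} (hg : IsWeakDeriv 1 f g)
    (hh : IsWeakDeriv s g h) : IsWeakDeriv (s + 1) f h := by
  intro φ hφ hc hs
  have hsm : ContDiff ℝ ((⊤ : ℕ∞) : WithTop ℕ∞) (iteratedDeriv s φ) := by
    rw [iteratedDeriv_eq_iterate]
    exact ContDiff.iterate_deriv s hφ
  have h1 := hg (iteratedDeriv s φ) hsm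
    (hc.of_isClosed_subset (isClosed_tsupport _) (tsupport_iteratedDeriv_subset φ s))
    ((tsupport_iteratedDeriv_subset φ s).trans hs)
  rw [iteratedDeriv_one, ← iteratedDeriv_succ] at h1
  rw [h1, hh φ hφ hc hs, pow_succ]
  ring

theorem exists_isWeakDeriv_one {r : ℝ} (hr : 0 ≤ r) {f : L2I}
    (hf : sobolevNormSq (r + 1) f < ∞) :
    ∃ g, IsWeakDeriv 1 f g ∧
      sobolevNormSq r g ≤ ENNReal.ofReal ((2 * Real.pi) ^ 2) * sobolevNormSq (r + 1) f := by
  set a : ℕ → ℝ := fun i => trigFreq i * inner ℝ f (trig (trigSwap i + 1)) with ha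
  have hbound : ∑' i, ENNReal.ofReal (sobolevWeight r (i + 1) * a i ^ 2) ≤
      ENNReal.ofReal ((2 * Real.pi) ^ 2) * sobolevNormSq (r + 1) f := by
    rw [sobolevNormSq, ← ENNReal.tsum_mul_left, ← trigSwapEquiv.tsum_eq
      (fun i => ENNReal.ofReal _ * ENNReal.ofReal (sobolevWeight (r + 1) (i + 1) * _))]
    refine ENNReal.tsum_le_tsum fun i => ?_
    have hsw : trigSwapEquiv i = trigSwap i := rfl
    rw [← ENNReal.ofReal_mul (by positivity), hsw, sobolevWeight_trigSwap]
    refine ENNReal.ofReal_le_ofReal ?_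
    have := mul_le_mul_of_nonneg_right (sobolevWeight_mul_trigFreq_sq_le r i)
      (sq_nonneg (inner ℝ f (trig (trigSwap i + 1)) : ℝ))
    calc _ = sobolevWeight r (i + 1) * trigFreq i ^ 2 *
          (inner ℝ f (trig (trigSwap i + 1)) : ℝ) ^ 2 := by rw [ha]; ring
      _ ≤ _ := this
      _ = _ := by ring
  have hfin : ∑' i, ENNReal.ofReal (a i ^ 2) ≠ ∞ := by
    refine ne_top_of_le_ne_top
      (ENNReal.mul_lt_top ENNReal.ofReal_lt_top hf).ne (le_trans ?_ hbound)
    refine ENNReal.tsum_le_tsum fun i => ENNReal.ofReal_le_ofReal ?_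
    exact le_mul_of_one_le_left (sq_nonneg _) (one_le_sobolevWeight hr (by omega))
  have hsum : Summable fun i => a i ^ 2 := by
    simpa [ENNReal.toReal_ofReal (sq_nonneg _)] using ENNReal.summable_toReal hfin
  have hmem : Memℓp a 2 := by
    refine memℓp_gen ?_
    simpa using hsum
  have hg : ∀ i, (inner ℝ (trigBasis.repr.symm ⟨a, hmem⟩) (trig (i + 1)) : ℝ) = a i := by
    intro i
    rw [real_inner_comm, ← trigBasis_apply, ← trigBasis.repr_apply_apply,
      LinearIsometryEquiv.apply_symm_apply]
  refine ⟨trigBasis.repr.symm ⟨a, hmem⟩, isWeakDeriv_one_of_coeff hg, ?_⟩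
  simpa only [sobolevNormSq, hg] using hbound

/-- A function with finite Sobolev norm of order `s` has an `s`-th weak derivative, and the
norm of the latter is controlled. -/
theorem exists_isWeakDeriv (s : ℕ) {f : L2I} (hf : sobolevNormSq s f < ∞) :
    ∃ g, IsWeakDeriv s f g ∧
      ENNReal.ofReal (‖g‖ ^ 2) ≤ ENNReal.ofReal ((2 * Real.pi) ^ (2 * s)) * sobolevNormSq s f := by
  induction s generalizing f with
  | zero =>
    refine ⟨f, fun φ _ _ _ => by simp, ?_⟩
    simp [sobolevNormSq_zero]
  | succ s ih =>
    rw [Nat.cast_succ] at hf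
    obtain ⟨g, hg, hgb⟩ := exists_isWeakDeriv_one (Nat.cast_nonneg s) hf
    obtain ⟨h, hh, hhb⟩ := ih
      (hgb.trans_lt (ENNReal.mul_lt_top ENNReal.ofReal_lt_top hf))
    refine ⟨h, hg.succ hh, hhb.trans ?_⟩
    rw [Nat.cast_succ]
    calc _ ≤ ENNReal.ofReal ((2 * Real.pi) ^ (2 * s)) *
          (ENNReal.ofReal ((2 * Real.pi) ^ 2) * sobolevNormSq (s + 1) f) := by gcongr
      _ = _ := by
        rw [← mul_assoc, ← ENNReal.ofReal_mul (by positivity)]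
        congr 2; ring

theorem enorm_weakDeriv_sub_sq_le (s : ℕ) {f g : L2I} (hf : sobolevNormSq s f < ∞)
    (hg : sobolevNormSq s g < ∞) :
    ‖weakDeriv s f - weakDeriv s g‖ₑ ^ 2 ≤
      ENNReal.ofReal ((2 * Real.pi) ^ (2 * s)) * sobolevNormSq s (f - g) := by
  by_cases hfg : sobolevNormSq s (f - g) < ∞
  · obtain ⟨f', hf', -⟩ := exists_isWeakDeriv s hf
    obtain ⟨g', hg', -⟩ := exists_isWeakDeriv s hg
    obtain ⟨h, hh, hb⟩ := exists_isWeakDeriv s hfg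
    rw [weakDeriv_eq hf', weakDeriv_eq hg', (hf'.sub hg').unique hh, ← ofReal_norm,
      ← ENNReal.ofReal_pow (norm_nonneg _)]
    exact hb
  · rw [not_lt_top_iff.1 hfg, ENNReal.mul_top]
    · exact le_top
    · simp; positivity

/-! ### The covariance operator and the moments of the regressor -/

section Covariance

variable {Ω : Type u} [MeasurableSpace Ω] {P : Measure Ω} {X : Ω → L2I}

theorem integrable_inner_mul_inner (hX : MemLp X 2 P) (f g : L2I) :
    Integrable (fun ω => (inner ℝ (X ω) f : ℝ) * inner ℝ (X ω) g) P := by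
  have h : ∀ f : L2I, MemLp (fun ω => (inner ℝ (X ω) f : ℝ)) 2 P := fun f =>
    hX.inner_const f
  exact (h f).integrable_mul (h g)

theorem inner_covOp (hX : MemLp X 2 P) (f g : L2I) :
    (inner ℝ (covOp P X f) g : ℝ) = ∫ ω, (inner ℝ (X ω) f : ℝ) * inner ℝ (X ω) g ∂P := by
  have hint : Integrable (fun ω => (inner ℝ (X ω) f : ℝ) • X ω) P := by
    have hn : Integrable (fun ω => ‖f‖ * ‖X ω‖ ^ 2) P := hX.integrable_norm_pow two_ne_zero
      |>.const_mul _
    have hm : AEStronglyMeasurable (fun ω => (inner ℝ (X ω) f : ℝ)) P :=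
      (hX.inner_const f).aestronglyMeasurable
    refine hn.mono' (hm.smul hX.aestronglyMeasurable) ?_
    refine Eventually.of_forall fun ω => ?_
    rw [norm_smul]
    have := norm_inner_le_norm (𝕜 := ℝ) (X ω) f
    nlinarith [norm_nonneg (X ω)]
  rw [covOp, real_inner_comm, ← integral_inner hint]
  simp only [inner_smul_right]
  simp only [real_inner_comm g]

/-- The integral operator with kernel `c (t - s)`, `c` even and `1`-periodic, is diagonal in the
trigonometric basis, by the addition theorems. -/
theorem integral_kernel_mul_trigFun {c : ℝ → ℝ} (hper : Function.Periodic c 1)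
    (heven : ∀ t, c (-t) = c t) (hint : IntervalIntegrable c volume 0 1) {j : ℕ} (hj : 1 ≤ j) :
    ∃ μ : ℝ, ∀ s : ℝ, ∫ t in (0 : ℝ)..1, c (t - s) * trigFun j t = μ * trigFun j s := by
  -- The substitution `u = t - s`; periodicity moves the interval back to `[0,1]`.
  have hshift : ∀ g : ℝ → ℝ, Function.Periodic g 1 → ∀ s : ℝ,
      ∫ t in (0 : ℝ)..1, c (t - s) * g t = ∫ u in (0 : ℝ)..1, c u * g (u + s) := by
    intro g hg s
    have h1 := intervalIntegral.integral_comp_sub_right (a := 0) (b := 1)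
      (fun u => c u * g (u + s)) s
    simp only [sub_add_cancel] at h1
    have hp : Function.Periodic (fun u => c u * g (u + s)) 1 := by
      intro u
      simp only [hper u, show u + 1 + s = u + s + 1 by ring, hg (u + s)]
    have h2 := hp.intervalIntegral_add_eq (0 - s) 0
    rw [h1, show (1 : ℝ) - s = 0 - s + 1 by ring, h2, zero_add]
  have hcos : ∀ k : ℕ, IntervalIntegrable (fun u => c u * Real.cos (2 * Real.pi * k * u))
      volume 0 1 := fun k => hint.mul_continuousOn (by fun_prop)
  have hsin : ∀ k : ℕ, IntervalIntegrable (fun u => c u * Real.sin (2 * Real.pi * k * u))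
      volume 0 1 := fun k => hint.mul_continuousOn (by fun_prop)
  -- The sine coefficients of the even function `c` vanish.
  have hodd : ∀ k : ℕ, ∫ u in (0 : ℝ)..1, c u * Real.sin (2 * Real.pi * k * u) = 0 := by
    intro k
    have h1 := intervalIntegral.integral_comp_sub_left (a := 0) (b := 1)
      (fun u => c u * Real.sin (2 * Real.pi * k * u)) 1
    have h2 : ∀ u : ℝ, c (1 - u) * Real.sin (2 * Real.pi * k * (1 - u)) =
        -(c u * Real.sin (2 * Real.pi * k * u)) := by
      intro u
      rw [show (1 : ℝ) - u = -u + 1 by ring, hper (-u), heven,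
        show 2 * Real.pi * k * (-u + 1) = -(2 * Real.pi * k * u) + k * (2 * Real.pi) by ring,
        Real.sin_add_nat_mul_two_pi, Real.sin_neg]
      ring
    simp only [h2, intervalIntegral.integral_neg, sub_zero, sub_self] at h1
    linarith
  have pcos : ∀ k : ℕ, Function.Periodic (fun t : ℝ => √2 * Real.cos (2 * Real.pi * k * t)) 1 := by
    intro k t
    simp only
    rw [show 2 * Real.pi * k * (t + 1) = 2 * Real.pi * k * t + k * (2 * Real.pi) by ring,
      Real.cos_add_nat_mul_two_pi]
  have psin : ∀ k : ℕ, Function.Periodic (fun t : ℝ => √2 * Real.sin (2 * Real.pi * k * t)) 1 := by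
    intro k t
    simp only
    rw [show 2 * Real.pi * k * (t + 1) = 2 * Real.pi * k * t + k * (2 * Real.pi) by ring,
      Real.sin_add_nat_mul_two_pi]
  rcases eq_one_or_even_or_odd hj with rfl | ⟨k, hk, rfl⟩ | ⟨k, hk, rfl⟩
  · refine ⟨∫ u in (0 : ℝ)..1, c u * 1, fun s => ?_⟩
    simp only [trigFun_one]
    rw [hshift (fun _ => 1) (fun _ => rfl), mul_one]
  · refine ⟨∫ u in (0 : ℝ)..1, c u * Real.cos (2 * Real.pi * k * u), fun s => ?_⟩
    simp only [trigFun_even]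
    rw [hshift _ (pcos k)]
    have : ∀ u : ℝ, c u * (√2 * Real.cos (2 * Real.pi * k * (u + s))) =
        (√2 * Real.cos (2 * Real.pi * k * s)) * (c u * Real.cos (2 * Real.pi * k * u)) -
          (√2 * Real.sin (2 * Real.pi * k * s)) * (c u * Real.sin (2 * Real.pi * k * u)) := by
      intro u
      rw [mul_add, Real.cos_add]; ring
    simp only [this]
    rw [intervalIntegral.integral_sub ((hcos k).const_mul _) ((hsin k).const_mul _),
      intervalIntegral.integral_const_mul, intervalIntegral.integral_const_mul, hodd]
    ring
  · refine ⟨∫ u in (0 : ℝ)..1, c u * Real.cos (2 * Real.pi * k * u), fun s => ?_⟩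
    simp only [trigFun_odd hk]
    rw [hshift _ (psin k)]
    have : ∀ u : ℝ, c u * (√2 * Real.sin (2 * Real.pi * k * (u + s))) =
        (√2 * Real.sin (2 * Real.pi * k * s)) * (c u * Real.cos (2 * Real.pi * k * u)) +
          (√2 * Real.cos (2 * Real.pi * k * s)) * (c u * Real.sin (2 * Real.pi * k * u)) := by
      intro u
      rw [mul_add, Real.sin_add]; ring
    simp only [this]
    rw [intervalIntegral.integral_add ((hcos k).const_mul _) ((hsin k).const_mul _),
      intervalIntegral.integral_const_mul, intervalIntegral.integral_const_mul, hodd]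
    ring

theorem IsSecondOrderStationary.isTrigDiagonal (h : IsSecondOrderStationary P X) :
    IsTrigDiagonal P X := by
  obtain ⟨c, hmeas, hper, heven, hpd, hker⟩ := h
  -- Positive definiteness at the two points `0`, `t` bounds `c`.
  have hbd : ∀ t, ‖c t‖ ≤ c 0 := by
    intro t
    have h1 := hpd 2 ![0, t] ![1, 1]
    have h2 := hpd 2 ![0, t] ![1, -1]
    simp [Fin.sum_univ_two, heven] at h1 h2
    rw [Real.norm_eq_abs, abs_le]
    constructor <;> linarith
  have hint : IntervalIntegrable c volume 0 1 := by
    refine (intervalIntegrable_const (c := c 0)).mono_fun hmeas.aestronglyMeasurable ?_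
    exact Eventually.of_forall fun t => (hbd t).trans (le_abs_self _)
  intro j hj
  obtain ⟨μ, hμ⟩ := integral_kernel_mul_trigFun hper heven hint hj
  have hcov : covOp P X (trig j) = μ • trig j := by
    refine Lp.ext ?_
    filter_upwards [hker (trig j), Lp.coeFn_smul μ (trig j), (trigFun_memLp j).coeFn_toLp]
      with s h1 h2 h3
    rw [h1, h2, Pi.smul_apply, trig, h3, smul_eq_mul, ← hμ s, ← trig,
      intervalIntegral.integral_of_le zero_le_one, ← integral_Icc_eq_integral_Ioc]
    refine integral_congr_ae ?_
    filter_upwards [(trigFun_memLp j).coeFn_toLp] with t ht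
    rw [trig, ht]
  rw [trigEigenvalue, hcov, inner_smul_left, inner_trig_of_one_le hj hj]
  simp

end Covariance

theorem tsum_mul_pow_four_le (a b : ℕ → ℝ≥0∞) :
    (∑' i, a i * b i) ^ 4 ≤ (∑' i, a i) ^ 3 * ∑' i, a i * b i ^ 4 := by
  refine le_of_tendsto' ((ENNReal.continuous_pow 4).continuousAt.tendsto.comp
    (ENNReal.summable (f := fun i => a i * b i)).hasSum) fun F => ?_
  have h := ENNReal.inner_le_weight_mul_Lp_of_nonneg F (p := 4) (by norm_num) a b
  have h4 := pow_le_pow_left' h 4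
  rw [mul_pow, ← ENNReal.rpow_natCast, ← ENNReal.rpow_natCast, ← ENNReal.rpow_natCast,
    ← ENNReal.rpow_mul, ← ENNReal.rpow_mul] at h4
  norm_num at h4
  refine h4.trans ?_
  gcongr
  · exact ENNReal.sum_le_tsum _
  · simpa using ENNReal.sum_le_tsum (f := fun i => a i * b i ^ 4) F

section Moments

variable {Ω : Type u} [MeasurableSpace Ω] {P : Measure Ω} {X : Ω → L2I}
  {υ : ℕ → ℝ} {d η : ℝ} {r : ℕ}

theorem IsRegressor.covOp_trig (h : IsRegressor P υ d η r X) {j : ℕ} (hj : 1 ≤ j) :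
    covOp P X (trig j) = trigEigenvalue P X j • trig j :=
  (h.spectral.elim IsSecondOrderStationary.isTrigDiagonal id) j hj

theorem IsRegressor.integral_inner_mul_inner (h : IsRegressor P υ d η r X) {j : ℕ} (hj : 1 ≤ j)
    (f : L2I) : ∫ ω, (inner ℝ (X ω) (trig j) : ℝ) * inner ℝ (X ω) f ∂P =
      trigEigenvalue P X j * inner ℝ f (trig j) := by
  rw [← inner_covOp h.memLp, h.covOp_trig hj, inner_smul_left, real_inner_comm]
  simp

theorem IsRegressor.le_trigEigenvalue (h : IsRegressor P υ d η r X) {j : ℕ} (hj : 1 ≤ j)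
    (hυ : 0 < υ j) : υ j / d ≤ trigEigenvalue P X j := by
  have := (h.link j hj).1
  rw [le_div_iff₀ hυ] at this
  calc υ j / d = 1 / d * υ j := by ring
    _ ≤ _ := this

theorem IsRegressor.trigEigenvalue_le (h : IsRegressor P υ d η r X) {j : ℕ} (hj : 1 ≤ j)
    (hυ : 0 < υ j) : trigEigenvalue P X j ≤ d * υ j := by
  have := (h.link j hj).2
  rwa [div_le_iff₀ hυ] at this

theorem lintegral_pow_eight_le [IsProbabilityMeasure P] {f : Ω → ℝ} (hr : 8 ≤ r) (hη : 0 ≤ η)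
    (h : ∫⁻ ω, ENNReal.ofReal (|f ω| ^ r) ∂P ≤ ENNReal.ofReal η) :
    ∫⁻ ω, ENNReal.ofReal (f ω ^ 8) ∂P ≤ ENNReal.ofReal (1 + η) := by
  calc ∫⁻ ω, ENNReal.ofReal (f ω ^ 8) ∂P
      ≤ ∫⁻ ω, (1 + ENNReal.ofReal (|f ω| ^ r)) ∂P := by
        refine lintegral_mono fun ω => ?_
        rw [← ENNReal.ofReal_one, ← ENNReal.ofReal_add zero_le_one (by positivity)]
        refine ENNReal.ofReal_le_ofReal ?_
        have h8 : f ω ^ 8 = |f ω| ^ 8 := by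
          rw [show (8 : ℕ) = 2 * 4 by norm_num, pow_mul, pow_mul, sq_abs]
        rw [h8]
        rcases le_total |f ω| 1 with h1 | h1
        · have := pow_le_one₀ (n := 8) (abs_nonneg (f ω)) h1
          have := pow_nonneg (abs_nonneg (f ω)) r
          linarith
        · have := pow_le_pow_right₀ h1 hr
          linarith
    _ = 1 + ∫⁻ ω, ENNReal.ofReal (|f ω| ^ r) ∂P := by
        rw [lintegral_add_left measurable_const]; simp
    _ ≤ 1 + ENNReal.ofReal η := by gcongr
    _ = ENNReal.ofReal (1 + η) := by
        rw [ENNReal.ofReal_add zero_le_one hη, ENNReal.ofReal_one]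

/-- The eighth moment of `‖X‖`, from Parseval's identity `‖X‖² = ∑_j λ_j (⟨X, ψ_j⟩ / √λ_j)²` and
convexity. -/
theorem IsRegressor.lintegral_norm_pow_eight_le [IsProbabilityMeasure P]
    (h : IsRegressor P υ d η r X) (hr : 8 ≤ r) (hη : 0 ≤ η) (hd : 0 < d)
    (hυ : ∀ j, 1 ≤ j → 0 < υ j) (hs : Summable fun i => υ (i + 1)) :
    ∫⁻ ω, ENNReal.ofReal (‖X ω‖ ^ 8) ∂P ≤
      ENNReal.ofReal ((d * ∑' i, υ (i + 1)) ^ 4 * (1 + η)) := by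
  set l : ℕ → ℝ := fun i => trigEigenvalue P X (i + 1)
  set z : ℕ → Ω → ℝ := fun i ω => inner ℝ (X ω) (trig (i + 1)) / √(l i) with hz
  have hlpos : ∀ i, 0 < l i := fun i => lt_of_lt_of_le
    (div_pos (hυ (i + 1) (by omega)) hd) (h.le_trigEigenvalue (by omega) (hυ _ (by omega)))
  have hzm : ∀ i, Measurable (z i) := fun i =>
    (((continuous_id.inner continuous_const).measurable.comp h.measurable)).div_const _
  have hsq : ∀ i ω, (inner ℝ (X ω) (trig (i + 1)) : ℝ) ^ 2 = l i * z i ω ^ 2 := by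
    intro i ω
    rw [hz]
    simp only
    rw [div_pow, Real.sq_sqrt (hlpos i).le, mul_div_cancel₀ _ (hlpos i).ne']
  have hL : ∑' i, ENNReal.ofReal (l i) ≤ ENNReal.ofReal (d * ∑' i, υ (i + 1)) := by
    rw [← tsum_mul_left, ENNReal.ofReal_tsum_of_nonneg
      (fun i => mul_nonneg hd.le (hυ _ (by omega)).le) (hs.mul_left d)]
    exact ENNReal.tsum_le_tsum fun i => ENNReal.ofReal_le_ofReal
      (h.trigEigenvalue_le (by omega) (hυ _ (by omega)))
  have hpt : ∀ ω, ENNReal.ofReal (‖X ω‖ ^ 8) ≤ (∑' i, ENNReal.ofReal (l i)) ^ 3 *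
      ∑' i, ENNReal.ofReal (l i) * ENNReal.ofReal (z i ω ^ 8) := by
    intro ω
    have h1 := tsum_mul_pow_four_le (fun i => ENNReal.ofReal (l i))
      (fun i => ENNReal.ofReal (z i ω ^ 2))
    simp only [← ENNReal.ofReal_mul (hlpos _).le, ← hsq, tsum_inner_trig_sq] at h1
    rw [← ENNReal.ofReal_pow (by positivity), ← pow_mul] at h1
    simp only [← ENNReal.ofReal_pow (sq_nonneg _), ← pow_mul] at h1
    exact h1
  calc ∫⁻ ω, ENNReal.ofReal (‖X ω‖ ^ 8) ∂P
      ≤ ∫⁻ ω, (∑' i, ENNReal.ofReal (l i)) ^ 3 *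
          ∑' i, ENNReal.ofReal (l i) * ENNReal.ofReal (z i ω ^ 8) ∂P := lintegral_mono hpt
    _ = (∑' i, ENNReal.ofReal (l i)) ^ 3 *
          ∑' i, ENNReal.ofReal (l i) * ∫⁻ ω, ENNReal.ofReal (z i ω ^ 8) ∂P := by
        have hm : ∀ i, Measurable fun ω => ENNReal.ofReal (z i ω ^ 8) := fun i =>
          ((hzm i).pow_const 8).ennreal_ofReal
        rw [lintegral_const_mul _ (Measurable.tsum fun i => (hm i).const_mul _),
          lintegral_tsum fun i => ((hm i).const_mul _).aemeasurable]
        simp only [lintegral_const_mul _ (hm _)]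
    _ ≤ (∑' i, ENNReal.ofReal (l i)) ^ 3 *
          ∑' i, ENNReal.ofReal (l i) * ENNReal.ofReal (1 + η) := by
        gcongr with i
        exact lintegral_pow_eight_le hr hη (h.moment (i + 1) (by omega))
    _ = (∑' i, ENNReal.ofReal (l i)) ^ 4 * ENNReal.ofReal (1 + η) := by
        rw [ENNReal.tsum_mul_right]; ring
    _ ≤ ENNReal.ofReal (d * ∑' i, υ (i + 1)) ^ 4 * ENNReal.ofReal (1 + η) := by gcongr
    _ = _ := by
        have : 0 ≤ ∑' i, υ (i + 1) := tsum_nonneg fun i => (hυ _ (by omega)).le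
        rw [← ENNReal.ofReal_pow (by positivity), ← ENNReal.ofReal_mul (by positivity)]

end Moments

/-! ### Deviation bounds for averages of independent variables -/

section Averages

variable {Ω : Type u} [MeasurableSpace Ω] {P : Measure Ω}

theorem integrable_and_integral_le_of_lintegral_le {f : Ω → ℝ} (hf : AEMeasurable f P)
    (h0 : ∀ ω, 0 ≤ f ω) {K : ℝ} (hK : 0 ≤ K)
    (h : ∫⁻ ω, ENNReal.ofReal (f ω) ∂P ≤ ENNReal.ofReal K) :
    Integrable f P ∧ ∫ ω, f ω ∂P ≤ K := by
  have hi : Integrable f P := ⟨hf.aestronglyMeasurable,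
    (hasFiniteIntegral_iff_ofReal (Eventually.of_forall h0)).2 (h.trans_lt ENNReal.ofReal_lt_top)⟩
  refine ⟨hi, ?_⟩
  rw [← ofReal_integral_eq_lintegral_ofReal hi (Eventually.of_forall h0)] at h
  exact (ENNReal.ofReal_le_ofReal_iff hK).1 h

theorem sq_average_le {n : ℕ} (hn : 0 < n) (f : Fin n → ℝ) :
    ((1 / (n : ℝ)) * ∑ i, f i) ^ 2 ≤ (1 / (n : ℝ)) * ∑ i, f i ^ 2 := by
  have hn' : (0 : ℝ) < n := by exact_mod_cast hn
  have h := sq_sum_le_card_mul_sum_sq (s := Finset.univ) (f := f)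
  rw [Finset.card_univ, Fintype.card_fin] at h
  calc ((1 / (n : ℝ)) * ∑ i, f i) ^ 2 = (1 / (n : ℝ)) ^ 2 * (∑ i, f i) ^ 2 := by ring
    _ ≤ (1 / (n : ℝ)) ^ 2 * (n * ∑ i, f i ^ 2) := by gcongr
    _ = _ := by field_simp

theorem pow_four_average_le {n : ℕ} (hn : 0 < n) (f : Fin n → ℝ) :
    ((1 / (n : ℝ)) * ∑ i, f i) ^ 4 ≤ (1 / (n : ℝ)) * ∑ i, f i ^ 4 := by
  have h1 := sq_average_le hn f
  have h2 := sq_average_le hn fun i => f i ^ 2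
  simp only [← pow_mul] at h2
  calc _ = (((1 / (n : ℝ)) * ∑ i, f i) ^ 2) ^ 2 := by ring
    _ ≤ ((1 / (n : ℝ)) * ∑ i, f i ^ 2) ^ 2 := by gcongr
    _ ≤ _ := h2

theorem exp_neg_le_quadratic {x : ℝ} (hx : 0 ≤ x) : Real.exp (-x) ≤ 1 - x + x ^ 2 / 2 := by
  have h1 := Real.quadratic_le_exp_of_nonneg hx
  have h2 : Real.exp (-x) * Real.exp x = 1 := by rw [← Real.exp_add]; simp
  have h3 : 0 < Real.exp (-x) := Real.exp_pos _
  -- `(1 - x + x²/2)(1 + x + x²/2) = 1 + x⁴/4`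
  have h4 : Real.exp (-x) * (1 + x + x ^ 2 / 2) ≤ (1 - x + x ^ 2 / 2) * (1 + x + x ^ 2 / 2) := by
    have : Real.exp (-x) * (1 + x + x ^ 2 / 2) ≤ 1 :=
      (mul_le_mul_of_nonneg_left h1 h3.le).trans_eq h2
    nlinarith [sq_nonneg (x ^ 2)]
  exact le_of_mul_le_mul_right h4 (by positivity)

/-- Lower tail of an average of independent nonnegative variables with mean one: by Chernoff's
bound, second moments suffice for an exponential rate. -/
theorem measure_average_lt_half_le [IsProbabilityMeasure P] {n : ℕ} {Z : Fin n → Ω → ℝ}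
    (hZ : ∀ i, AEMeasurable (Z i) P) (h0 : ∀ i ω, 0 ≤ Z i ω) (hind : iIndepFun Z P)
    {v : ℝ} (hv : 0 < v) (h1 : ∀ i, ∫ ω, Z i ω ∂P = 1)
    (h2 : ∀ i, Integrable (fun ω => Z i ω ^ 2) P) (h2v : ∀ i, ∫ ω, Z i ω ^ 2 ∂P ≤ v)
    (hn : 0 < n) :
    P {ω | (1 / (n : ℝ)) * ∑ i, Z i ω < 1 / 2} ≤ ENNReal.ofReal (Real.exp (-(n / (8 * v)))) := by
  have hn' : (0 : ℝ) < n := by exact_mod_cast hn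
  set t : ℝ := 1 / (2 * v) with ht
  have htpos : 0 < t := by positivity
  have hint1 : ∀ i, Integrable (Z i) P := fun i => by
    by_contra hc
    have := h1 i
    rw [integral_undef hc] at this
    exact zero_ne_one this
  have hexp : ∀ i, Integrable (fun ω => Real.exp (-t * Z i ω)) P := fun i => by
    refine (integrable_const (1 : ℝ)).mono'
      ((Real.measurable_exp.comp_aemeasurable ((hZ i).const_mul _)).aestronglyMeasurable)
      (Eventually.of_forall fun ω => ?_)
    rw [Real.norm_eq_abs, Real.abs_exp, Real.exp_le_one_iff]
    nlinarith [h0 i ω]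
  have hmgf : ∀ i, mgf (Z i) P (-t) ≤ Real.exp (-t + t ^ 2 * v / 2) := by
    intro i
    calc mgf (Z i) P (-t) = ∫ ω, Real.exp (-t * Z i ω) ∂P := rfl
      _ ≤ ∫ ω, ((1 - t * Z i ω) + t ^ 2 / 2 * Z i ω ^ 2) ∂P := by
          refine integral_mono (hexp i) (((integrable_const 1).sub ((hint1 i).const_mul t)).add
            ((h2 i).const_mul _)) fun ω => ?_
          have := exp_neg_le_quadratic (mul_nonneg htpos.le (h0 i ω))
          simp only [neg_mul]
          linarith [this, show (t * Z i ω) ^ 2 / 2 = t ^ 2 / 2 * Z i ω ^ 2 by ring]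
      _ = 1 - t + t ^ 2 / 2 * ∫ ω, Z i ω ^ 2 ∂P := by
          have hl : Integrable (fun ω => 1 - t * Z i ω) P :=
            (integrable_const 1).sub ((hint1 i).const_mul t)
          rw [integral_add hl ((h2 i).const_mul _),
            integral_sub (integrable_const 1) ((hint1 i).const_mul t),
            integral_const_mul, integral_const_mul, h1 i]
          simp
      _ ≤ (-t + t ^ 2 * v / 2) + 1 := by
          have := mul_le_mul_of_nonneg_left (h2v i) (by positivity : 0 ≤ t ^ 2 / 2)
          linarith
      _ ≤ _ := Real.add_one_le_exp _
  have hsum : Integrable (fun ω => Real.exp (-t * (∑ i, Z i) ω)) P := by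
    refine (integrable_const (1 : ℝ)).mono' ?_ (Eventually.of_forall fun ω => ?_)
    · exact (Real.measurable_exp.comp_aemeasurable
        ((Finset.aemeasurable_sum _ fun i _ => hZ i).const_mul _)).aestronglyMeasurable
    · rw [Real.norm_eq_abs, Real.abs_exp, Real.exp_le_one_iff, Finset.sum_apply]
      have := Finset.sum_nonneg fun i (_ : i ∈ Finset.univ) => h0 i ω
      nlinarith
  have hch := measure_le_le_exp_mul_mgf (X := ∑ i, Z i) (μ := P) (n / 2 : ℝ)
    (neg_nonpos.2 htpos.le) hsum
  rw [hind.mgf_sum₀ hZ] at hch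
  have hprod : ∏ i : Fin n, mgf (Z i) P (-t) ≤ Real.exp (-t + t ^ 2 * v / 2) ^ n := by
    refine (Finset.prod_le_prod (fun i _ => mgf_nonneg) fun i _ => hmgf i).trans_eq ?_
    simp
  have hreal : P.real {ω | (∑ i, Z i) ω ≤ (n / 2 : ℝ)} ≤ Real.exp (-(n / (8 * v))) := by
    refine hch.trans ((mul_le_mul_of_nonneg_left hprod (Real.exp_pos _).le).trans_eq ?_)
    rw [← Real.exp_nat_mul, ← Real.exp_add, ht]
    congr 1
    field_simp
    ring
  calc P {ω | (1 / (n : ℝ)) * ∑ i, Z i ω < 1 / 2}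
      ≤ P {ω | (∑ i, Z i) ω ≤ (n / 2 : ℝ)} := by
        refine measure_mono fun ω hω => ?_
        simp only [Set.mem_ofPred_eq, Finset.sum_apply] at hω ⊢
        rw [one_div, inv_mul_lt_iff₀ hn'] at hω
        linarith
    _ ≤ _ := by
        rw [← ENNReal.ofReal_toReal (measure_ne_top P {ω | (∑ i, Z i) ω ≤ (n / 2 : ℝ)})]
        exact ENNReal.ofReal_le_ofReal hreal

/-- An average of centred independent variables has second moment of order `1 / n`. -/
theorem lintegral_sq_average_le [IsProbabilityMeasure P] {n : ℕ} {W : Fin n → Ω → ℝ}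
    (hind : iIndepFun W P) (h0 : ∀ i, ∫ ω, W i ω ∂P = 0) (h2 : ∀ i, MemLp (W i) 2 P) {K : ℝ}
    (hK : ∀ i, ∫ ω, W i ω ^ 2 ∂P ≤ K) (hn : 0 < n) :
    ∫⁻ ω, ENNReal.ofReal (((1 / (n : ℝ)) * ∑ i, W i ω) ^ 2) ∂P ≤ ENNReal.ofReal (K / n) := by
  have hn' : (0 : ℝ) < n := by exact_mod_cast hn
  have hS : MemLp (∑ i, W i) 2 P := memLp_finsetSum' _ fun i _ => h2 i
  have hvar := IndepFun.variance_sum (μ := P) (s := Finset.univ) (X := W) (fun i _ => h2 i)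
    fun i _ j _ hij => hind.indepFun hij
  have hS0 : ∫ ω, (∑ i, W i) ω ∂P = 0 := by
    simp only [Finset.sum_apply]
    rw [integral_finsetSum _ fun i _ => (h2 i).integrable one_le_two]
    simp [h0]
  rw [variance_of_integral_eq_zero hS.aemeasurable hS0] at hvar
  have hvar' : ∫ ω, (∑ i, W i) ω ^ 2 ∂P ≤ n * K := by
    rw [hvar]
    calc ∑ i, variance (W i) P ≤ ∑ _i : Fin n, K := Finset.sum_le_sum fun i _ => by
          rw [variance_of_integral_eq_zero (h2 i).aemeasurable (h0 i)]; exact hK i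
      _ = n * K := by simp
  have hint : Integrable (fun ω => ((1 / (n : ℝ)) * ∑ i, W i ω) ^ 2) P := by
    have := hS.integrable_sq.const_mul ((1 / (n : ℝ)) ^ 2)
    simpa only [Finset.sum_apply, mul_pow] using this
  rw [← ofReal_integral_eq_lintegral_ofReal hint (Eventually.of_forall fun ω => sq_nonneg _)]
  refine ENNReal.ofReal_le_ofReal ?_
  simp only [mul_pow, integral_const_mul]
  simp only [Finset.sum_apply] at hvar'
  calc _ ≤ (1 / (n : ℝ)) ^ 2 * (n * K) := by gcongr
    _ = K / n := by field_simp

/-- On an event of probability at most `q ^ 2`, the second moment of an average is at most a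
multiple of `q`, by the inequality `2 x ≤ q x ^ 2 + q⁻¹`. -/
theorem setLIntegral_sq_average_le [IsProbabilityMeasure P] {n : ℕ} {W : Fin n → Ω → ℝ}
    (hW : ∀ i, AEMeasurable (W i) P) {K : ℝ} (hK : 0 ≤ K)
    (h4 : ∀ i, ∫⁻ ω, ENNReal.ofReal (W i ω ^ 4) ∂P ≤ ENNReal.ofReal K) (hn : 0 < n)
    {A : Set Ω} {q : ℝ} (hq : 0 < q) (hA : P A ≤ ENNReal.ofReal (q ^ 2)) :
    ∫⁻ ω in A, ENNReal.ofReal (((1 / (n : ℝ)) * ∑ i, W i ω) ^ 2) ∂P ≤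
      ENNReal.ofReal ((1 + K) * q) := by
  have hn' : (0 : ℝ) < n := by exact_mod_cast hn
  have hpt : ∀ ω, ENNReal.ofReal (((1 / (n : ℝ)) * ∑ i, W i ω) ^ 2) ≤
      ENNReal.ofReal (1 / (2 * q)) +
        ENNReal.ofReal (q / (2 * n)) * ∑ i, ENNReal.ofReal (W i ω ^ 4) := by
    intro ω
    have h40 : ∀ i, 0 ≤ W i ω ^ 4 := fun i => by positivity
    rw [← ENNReal.ofReal_sum_of_nonneg fun i _ => h40 i, ← ENNReal.ofReal_mul (by positivity),
      ← ENNReal.ofReal_add (by positivity)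
        (mul_nonneg (by positivity) (Finset.sum_nonneg fun i _ => h40 i))]
    refine ENNReal.ofReal_le_ofReal ?_
    have h1 := pow_four_average_le hn fun i => W i ω
    set D := (1 / (n : ℝ)) * ∑ i, W i ω
    have h2 : D ^ 2 ≤ 1 / (2 * q) + q / 2 * D ^ 4 := by
      have : 1 / (2 * q) + q / 2 * D ^ 4 - D ^ 2 = q / 2 * (D ^ 2 - 1 / q) ^ 2 := by
        field_simp; ring
      have : 0 ≤ q / 2 * (D ^ 2 - 1 / q) ^ 2 := by positivity
      linarith
    calc D ^ 2 ≤ 1 / (2 * q) + q / 2 * D ^ 4 := h2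
      _ ≤ 1 / (2 * q) + q / 2 * ((1 / (n : ℝ)) * ∑ i, W i ω ^ 4) := by gcongr
      _ = _ := by field_simp
  have hm : ∀ i, AEMeasurable (fun ω => ENNReal.ofReal (W i ω ^ 4)) P := fun i =>
    ((hW i).pow_const 4).ennreal_ofReal
  calc _ ≤ ∫⁻ ω in A, (ENNReal.ofReal (1 / (2 * q)) +
        ENNReal.ofReal (q / (2 * n)) * ∑ i, ENNReal.ofReal (W i ω ^ 4)) ∂P := lintegral_mono hpt
    _ = ENNReal.ofReal (1 / (2 * q)) * P A +
        ∫⁻ ω in A, ENNReal.ofReal (q / (2 * n)) * ∑ i, ENNReal.ofReal (W i ω ^ 4) ∂P := by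
        rw [lintegral_add_left measurable_const, setLIntegral_const]
    _ ≤ ENNReal.ofReal (1 / (2 * q)) * ENNReal.ofReal (q ^ 2) +
        ∫⁻ ω, ENNReal.ofReal (q / (2 * n)) * ∑ i, ENNReal.ofReal (W i ω ^ 4) ∂P := by
        gcongr
        exact Measure.restrict_le_self
    _ = ENNReal.ofReal (1 / (2 * q)) * ENNReal.ofReal (q ^ 2) +
        ENNReal.ofReal (q / (2 * n)) * ∑ i, ∫⁻ ω, ENNReal.ofReal (W i ω ^ 4) ∂P := by
        rw [lintegral_const_mul'' _ (Finset.aemeasurable_fun_sum _ fun i _ => hm i),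
          lintegral_finsetSum' _ fun i _ => hm i]
    _ ≤ ENNReal.ofReal (1 / (2 * q)) * ENNReal.ofReal (q ^ 2) +
        ENNReal.ofReal (q / (2 * n)) * ∑ _i : Fin n, ENNReal.ofReal K := by
        gcongr with i
        exact h4 i
    _ = ENNReal.ofReal (q / 2 + q / 2 * K) := by
        rw [← ENNReal.ofReal_sum_of_nonneg fun _ _ => hK, ← ENNReal.ofReal_mul (by positivity),
          ← ENNReal.ofReal_mul (by positivity), ← ENNReal.ofReal_add (by positivity)
            (mul_nonneg (by positivity) (Finset.sum_nonneg fun _ _ => hK))]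
        congr 1
        simp only [Finset.sum_const, Finset.card_univ, Fintype.card_fin, nsmul_eq_mul]
        field_simp
    _ ≤ _ := by
        refine ENNReal.ofReal_le_ofReal ?_
        have : 0 ≤ K * q := by positivity
        nlinarith

/-- The deviation bounds for one coefficient: `z` are the standardized coefficients of the
regressors, `u` the parts of the responses that are uncorrelated with them. -/
theorem coefficient_deviation [IsProbabilityMeasure P] {n : ℕ} {z u : Fin n → Ω → ℝ} (hn : 0 < n)
    (hz : ∀ i, AEMeasurable (z i) P) (hu : ∀ i, AEMeasurable (u i) P)
    (hind : iIndepFun (fun i ω => (z i ω, u i ω)) P) {K : ℝ} (hK : 0 ≤ K)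
    (hz8 : ∀ i, ∫⁻ ω, ENNReal.ofReal (z i ω ^ 8) ∂P ≤ ENNReal.ofReal K)
    (hu8 : ∀ i, ∫⁻ ω, ENNReal.ofReal (u i ω ^ 8) ∂P ≤ ENNReal.ofReal K)
    (hz2 : ∀ i, ∫ ω, z i ω ^ 2 ∂P = 1) (huz : ∀ i, ∫ ω, u i ω * z i ω ∂P = 0) :
    P {ω | (1 / (n : ℝ)) * ∑ i, z i ω ^ 2 < 1 / 2} ≤
        ENNReal.ofReal (Real.exp (-(n / (8 * (1 + K))))) ∧
    ∫⁻ ω, ENNReal.ofReal (((1 / (n : ℝ)) * ∑ i, u i ω * z i ω) ^ 2) ∂P ≤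
        ENNReal.ofReal ((1 + K) / n) ∧
    ∫⁻ ω in {ω | (1 / (n : ℝ)) * ∑ i, z i ω ^ 2 < 1 / 2},
        ENNReal.ofReal (((1 / (n : ℝ)) * ∑ i, u i ω * z i ω) ^ 2) ∂P ≤
        ENNReal.ofReal ((1 + K) * Real.exp (-(n / (16 * (1 + K))))) := by
  have hzi : ∀ i, Integrable (fun ω => z i ω ^ 8) P ∧ ∫ ω, z i ω ^ 8 ∂P ≤ K := fun i =>
    integrable_and_integral_le_of_lintegral_le ((hz i).pow_const 8)
      (fun ω => by positivity) hK (hz8 i)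
  have hui : ∀ i, Integrable (fun ω => u i ω ^ 8) P ∧ ∫ ω, u i ω ^ 8 ∂P ≤ K := fun i =>
    integrable_and_integral_le_of_lintegral_le ((hu i).pow_const 8)
      (fun ω => by positivity) hK (hu8 i)
  have hindZ : iIndepFun (fun i ω => z i ω ^ 2) P :=
    hind.comp (fun _ x => x.1 ^ 2) fun _ => measurable_fst.pow_const 2
  have hindW : iIndepFun (fun i ω => u i ω * z i ω) P :=
    hind.comp (fun _ x => x.2 * x.1) fun _ => measurable_snd.mul measurable_fst
  -- `x ^ 4 ≤ 1 + x ^ 8`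
  have hz4 : ∀ i, Integrable (fun ω => (z i ω ^ 2) ^ 2) P ∧ ∫ ω, (z i ω ^ 2) ^ 2 ∂P ≤ 1 + K := by
    intro i
    have hd : Integrable (fun ω => 1 + z i ω ^ 8) P := (integrable_const 1).add (hzi i).1
    have hle : ∀ ω, (z i ω ^ 2) ^ 2 ≤ 1 + z i ω ^ 8 := fun ω => by
      nlinarith [sq_nonneg (z i ω ^ 4 - 1), sq_nonneg (z i ω ^ 4)]
    have hi : Integrable (fun ω => (z i ω ^ 2) ^ 2) P :=
      hd.mono' (((hz i).pow_const 2).pow_const 2).aestronglyMeasurable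
        (Eventually.of_forall fun ω => by
          rw [Real.norm_of_nonneg (by positivity)]; exact hle ω)
    refine ⟨hi, (integral_mono hi hd hle).trans ?_⟩
    rw [integral_add (integrable_const 1) (hzi i).1]
    simpa using (hzi i).2
  -- `(u z) ^ 2 ≤ (u ^ 4 + z ^ 4) / 2 ≤ 1 + (u ^ 8 + z ^ 8) / 2`
  have hW2 : ∀ i, Integrable (fun ω => (u i ω * z i ω) ^ 2) P ∧
      ∫ ω, (u i ω * z i ω) ^ 2 ∂P ≤ 1 + K := by
    intro i
    have hd : Integrable (fun ω => 1 + (1 / 2) * (u i ω ^ 8 + z i ω ^ 8)) P :=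
      (integrable_const 1).add (((hui i).1.add (hzi i).1).const_mul _)
    have hle : ∀ ω, (u i ω * z i ω) ^ 2 ≤ 1 + (1 / 2) * (u i ω ^ 8 + z i ω ^ 8) := fun ω => by
      nlinarith [sq_nonneg (z i ω ^ 4 - 1), sq_nonneg (u i ω ^ 4 - 1),
        sq_nonneg (u i ω ^ 2 - z i ω ^ 2)]
    have hi : Integrable (fun ω => (u i ω * z i ω) ^ 2) P :=
      hd.mono' (((hu i).mul (hz i)).pow_const 2).aestronglyMeasurable
        (Eventually.of_forall fun ω => by
          rw [Real.norm_of_nonneg (by positivity)]; exact hle ω)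
    refine ⟨hi, (integral_mono hi hd hle).trans ?_⟩
    have hl : Integrable (fun ω => (1 / 2) * (u i ω ^ 8 + z i ω ^ 8)) P :=
      ((hui i).1.add (hzi i).1).const_mul _
    rw [integral_add (integrable_const 1) hl, integral_const_mul, integral_add (hui i).1 (hzi i).1]
    have h1 := (hui i).2
    have h2 := (hzi i).2
    simp only [integral_const, probReal_univ, smul_eq_mul, mul_one]
    linarith
  have hW4 : ∀ i, ∫⁻ ω, ENNReal.ofReal ((u i ω * z i ω) ^ 4) ∂P ≤ ENNReal.ofReal K := by
    intro i
    have hd : Integrable (fun ω => (1 / 2) * (u i ω ^ 8 + z i ω ^ 8)) P :=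
      ((hui i).1.add (hzi i).1).const_mul _
    calc _ ≤ ∫⁻ ω, ENNReal.ofReal ((1 / 2) * (u i ω ^ 8 + z i ω ^ 8)) ∂P := by
          refine lintegral_mono fun ω => ENNReal.ofReal_le_ofReal ?_
          nlinarith [sq_nonneg (u i ω ^ 4 - z i ω ^ 4)]
      _ = ENNReal.ofReal (∫ ω, (1 / 2) * (u i ω ^ 8 + z i ω ^ 8) ∂P) :=
          (ofReal_integral_eq_lintegral_ofReal hd
            (Eventually.of_forall fun ω => by positivity)).symm
      _ ≤ _ := by
          refine ENNReal.ofReal_le_ofReal ?_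
          rw [integral_const_mul, integral_add (hui i).1 (hzi i).1]
          linarith [(hui i).2, (hzi i).2]
  have hA := measure_average_lt_half_le (Z := fun i ω => z i ω ^ 2)
    (fun i => (hz i).pow_const 2) (fun i ω => sq_nonneg _) hindZ
    (by linarith : 0 < 1 + K) hz2 (fun i => (hz4 i).1) (fun i => (hz4 i).2) hn
  refine ⟨hA, ?_, ?_⟩
  · exact lintegral_sq_average_le hindW huz
      (fun i => (memLp_two_iff_integrable_sq ((hu i).mul (hz i)).aestronglyMeasurable).2 (hW2 i).1)
      (fun i => (hW2 i).2) hn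
  · refine setLIntegral_sq_average_le (fun i => (hu i).mul (hz i)) hK hW4 hn
      (Real.exp_pos _) (hA.trans_eq ?_)
    rw [← Real.exp_nat_mul]
    congr 2
    push_cast
    field_simp
    norm_num

end Averages

/-! ### The risk of one coefficient of the estimator -/

theorem measurable_inner_const (f : L2I) : Measurable fun x : L2I => (inner ℝ x f : ℝ) :=
  (continuous_id.inner continuous_const).measurable

/-- A bound for the eighth moments of the standardized coefficients and of the parts of the
responses that are uncorrelated with them; `M` is a bound for the trace of the covariance operator,
and `128 = 2 ^ 7`, `256 = 2 ^ 8` come from convexity and the triangle inequality. -/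
noncomputable def momentBound (ρ σ η M : ℝ) : ℝ :=
  (1 + η) * (1 + 128 * (256 * ρ ^ 4 * M ^ 4 + σ ^ 8))

section Coefficient

variable {Ω : Type u} [MeasurableSpace Ω] {P : Measure Ω} {X : Ω → L2I} {ε : Ω → ℝ}
  {υ : ℕ → ℝ} {d η : ℝ} {r n : ℕ} {Xs : Fin n → Ω → L2I} {εs : Fin n → Ω → ℝ}

theorem IsSample.aemeasurable (h : IsSample P X ε Xs εs) {F : L2I × ℝ → ℝ} (hF : Measurable F)
    (i : Fin n) : AEMeasurable (fun ω => F (Xs i ω, εs i ω)) P :=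
  hF.comp_aemeasurable (h.identDistrib i).aemeasurable_fst

theorem IsSample.integral_eq (h : IsSample P X ε Xs εs) {F : L2I × ℝ → ℝ} (hF : Measurable F)
    (i : Fin n) : ∫ ω, F (Xs i ω, εs i ω) ∂P = ∫ ω, F (X ω, ε ω) ∂P :=
  ((h.identDistrib i).comp hF).integral_eq

theorem IsSample.lintegral_eq (h : IsSample P X ε Xs εs) {F : L2I × ℝ → ℝ} (hF : Measurable F)
    (i : Fin n) : ∫⁻ ω, ENNReal.ofReal (F (Xs i ω, εs i ω)) ∂P =
      ∫⁻ ω, ENNReal.ofReal (F (X ω, ε ω)) ∂P :=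
  ((h.identDistrib i).comp hF.ennreal_ofReal).lintegral_eq

theorem norm_sub_inner_smul_trig_le (β : L2I) {j : ℕ} (hj : 1 ≤ j) :
    ‖β - (inner ℝ β (trig j) : ℝ) • trig j‖ ≤ 2 * ‖β‖ := by
  have h1 : ‖trig j‖ = 1 := by
    have := inner_trig_of_one_le hj hj
    rw [real_inner_self_eq_norm_sq, if_pos rfl] at this
    exact (pow_eq_one_iff_of_nonneg (norm_nonneg _) two_ne_zero).1 this
  have h2 := norm_inner_le_norm (𝕜 := ℝ) β (trig j)
  rw [h1, mul_one] at h2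
  calc _ ≤ ‖β‖ + ‖(inner ℝ β (trig j) : ℝ) • trig j‖ := norm_sub_le _ _
    _ ≤ 2 * ‖β‖ := by rw [norm_smul, h1, mul_one]; linarith

/-- The eighth moment of the part of the response that is uncorrelated with `⟨X, ψ_j⟩`. -/
theorem lintegral_residual_pow_eight_le [IsProbabilityMeasure P] (hX : IsRegressor P υ d η r X)
    (hε : IsErrorTerm P η r ε) (hr : 8 ≤ r) (hη : 0 ≤ η) (hd : 0 < d)
    (hυ : ∀ j, 1 ≤ j → 0 < υ j) (hs : Summable fun i => υ (i + 1)) (σ : ℝ) {ρ : ℝ}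
    {β : L2I} (hβ : ‖β‖ ^ 2 ≤ ρ) {j : ℕ} (hj : 1 ≤ j) :
    ∫⁻ ω, ENNReal.ofReal ((inner ℝ (X ω) (β - (inner ℝ β (trig j) : ℝ) • trig j)
      + σ * ε ω) ^ 8) ∂P ≤ ENNReal.ofReal (momentBound ρ σ η (d * ∑' i, υ (i + 1))) := by
  set M := d * ∑' i, υ (i + 1) with hM
  set γ := β - (inner ℝ β (trig j) : ℝ) • trig j with hγ
  have hρ : 0 ≤ ρ := (sq_nonneg _).trans hβ
  have hγ8 : ‖γ‖ ^ 8 ≤ 256 * ρ ^ 4 := by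
    calc ‖γ‖ ^ 8 ≤ (2 * ‖β‖) ^ 8 := by gcongr; exact norm_sub_inner_smul_trig_le β hj
      _ = 256 * (‖β‖ ^ 2) ^ 4 := by ring
      _ ≤ 256 * ρ ^ 4 := by gcongr
  have hpt : ∀ ω, ENNReal.ofReal ((inner ℝ (X ω) γ + σ * ε ω) ^ 8) ≤
      ENNReal.ofReal (128 * (256 * ρ ^ 4)) * ENNReal.ofReal (‖X ω‖ ^ 8) +
        ENNReal.ofReal (128 * σ ^ 8) * ENNReal.ofReal (ε ω ^ 8) := by
    intro ω
    rw [← ENNReal.ofReal_mul (by positivity), ← ENNReal.ofReal_mul (by positivity),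
      ← ENNReal.ofReal_add (by positivity) (by positivity)]
    refine ENNReal.ofReal_le_ofReal ?_
    have h1 := Even.add_pow_le (n := 8) (a := (inner ℝ (X ω) γ : ℝ)) (b := σ * ε ω) (by decide)
    have h2 : (inner ℝ (X ω) γ : ℝ) ^ 8 ≤ 256 * ρ ^ 4 * ‖X ω‖ ^ 8 := by
      rw [← Even.pow_abs (by decide : Even 8)]
      calc |(inner ℝ (X ω) γ : ℝ)| ^ 8 ≤ (‖X ω‖ * ‖γ‖) ^ 8 := by
            gcongr; exact abs_real_inner_le_norm _ _
        _ = ‖γ‖ ^ 8 * ‖X ω‖ ^ 8 := by ring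
        _ ≤ _ := by gcongr
    norm_num at h1
    calc _ ≤ 128 * ((inner ℝ (X ω) γ : ℝ) ^ 8 + (σ * ε ω) ^ 8) := h1
      _ ≤ 128 * (256 * ρ ^ 4 * ‖X ω‖ ^ 8 + (σ * ε ω) ^ 8) := by gcongr
      _ = _ := by ring
  have hm : Measurable fun ω => ENNReal.ofReal (‖X ω‖ ^ 8) :=
    (hX.measurable.norm.pow_const 8).ennreal_ofReal
  have hm' : Measurable fun ω => ENNReal.ofReal (ε ω ^ 8) :=
    (hε.measurable.pow_const 8).ennreal_ofReal
  have hM0 : 0 ≤ M := mul_nonneg hd.le (tsum_nonneg fun i => (hυ _ (by omega)).le)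
  refine (lintegral_mono hpt).trans ?_
  rw [lintegral_add_left (hm.const_mul _), lintegral_const_mul _ hm, lintegral_const_mul _ hm']
  refine (add_le_add
    (mul_le_mul_right (hX.lintegral_norm_pow_eight_le hr hη hd hυ hs) _)
    (mul_le_mul_right (lintegral_pow_eight_le hr hη hε.moment) _)).trans ?_
  rw [← ENNReal.ofReal_mul (by positivity), ← ENNReal.ofReal_mul (by positivity),
    ← ENNReal.ofReal_add (by positivity) (by positivity)]
  refine ENNReal.ofReal_le_ofReal ?_
  rw [momentBound, ← hM]
  nlinarith

/-- The squared error of one coefficient. Where `L = λ̂ / λ` is at least `1/2` the first term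
suffices; the last two terms are due to the events `L < 1/2` and `λ̂ < α`. -/
theorem sq_coefficient_error_le {lam α L D b : ℝ} (hlam : 0 < lam) (hα : 0 < α) :
    ((if α ≤ lam * L then (√lam * D + b * (lam * L)) / (lam * L) else 0) - b) ^ 2 ≤
      4 / lam * D ^ 2 + (if L < 1 / 2 then lam / α ^ 2 * D ^ 2 else 0) +
        (if lam * L < α then b ^ 2 else 0) := by
  have h1 : 0 ≤ 4 / lam * D ^ 2 := by positivity
  have h2 : 0 ≤ lam / α ^ 2 * D ^ 2 := by positivity
  by_cases h : α ≤ lam * L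
  · rw [if_pos h, if_neg (not_lt.2 h)]
    have hpos : 0 < lam * L := hα.trans_le h
    have hL : 0 < L := pos_of_mul_pos_right hpos hlam.le
    have heq : ((√lam * D + b * (lam * L)) / (lam * L) - b) ^ 2 = lam * D ^ 2 / (lam * L) ^ 2 := by
      rw [add_div, mul_div_cancel_right₀ _ hpos.ne', add_sub_cancel_right, div_pow, mul_pow,
        Real.sq_sqrt hlam.le]
    rw [heq, add_zero]
    split_ifs with hL2
    · have : lam * D ^ 2 / (lam * L) ^ 2 ≤ lam * D ^ 2 / α ^ 2 := by gcongr
      rw [mul_div_right_comm] at this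
      rw [mul_div_right_comm] at this ⊢
      linarith
    · rw [add_zero, mul_pow, div_le_iff₀ (by positivity)]
      have h3 : 1 ≤ 4 * L ^ 2 := by nlinarith
      calc lam * D ^ 2 = lam * D ^ 2 * 1 := by ring
        _ ≤ lam * D ^ 2 * (4 * L ^ 2) := by gcongr
        _ = _ := by field_simp
  · rw [if_neg h, if_pos (not_le.1 h)]
    split_ifs <;> nlinarith

theorem lintegral_coefficient_error_le [IsProbabilityMeasure P] (hX : IsRegressor P υ d η r X)
    (hε : IsErrorTerm P η r ε) (hS : IsSample P X ε Xs εs) (hr : 8 ≤ r) (hη : 0 ≤ η) (hd : 0 < d)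
    (hυ : ∀ j, 1 ≤ j → 0 < υ j) (hs : Summable fun i => υ (i + 1)) (σ : ℝ) {ρ : ℝ}
    {β : L2I} (hβ : ‖β‖ ^ 2 ≤ ρ) {j : ℕ} (hj : 1 ≤ j) (hn : 0 < n) {α : ℝ} (hα : 0 < α)
    {K : ℝ} (hK : K = momentBound ρ σ η (d * ∑' i, υ (i + 1)))
    {lam : ℝ} (hlam : lam = trigEigenvalue P X j) :
    ∫⁻ ω, ENNReal.ofReal (((if α ≤ lambdaHat (fun i => Xs i ω) j then
        gHat (fun i => Xs i ω) (fun i => inner ℝ β (Xs i ω) + σ * εs i ω) j /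
          lambdaHat (fun i => Xs i ω) j else 0) - inner ℝ β (trig j)) ^ 2) ∂P ≤
      ENNReal.ofReal (4 / lam * ((1 + K) / n) +
        lam / α ^ 2 * ((1 + K) * Real.exp (-(n / (16 * (1 + K))))) +
        (inner ℝ β (trig j) : ℝ) ^ 2 *
          if 2 * α ≤ lam then Real.exp (-(n / (8 * (1 + K)))) else 1) := by
  have hρ : 0 ≤ ρ := (sq_nonneg _).trans hβ
  have hM0 : 0 ≤ d * ∑' i, υ (i + 1) :=
    mul_nonneg hd.le (tsum_nonneg fun i => (hυ _ (by omega)).le)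
  have hlpos : 0 < lam := hlam ▸ lt_of_lt_of_le (div_pos (hυ j hj) hd)
    (hX.le_trigEigenvalue hj (hυ j hj))
  have hKη : 1 + η ≤ K := by
    rw [hK, momentBound]
    have : 0 ≤ 128 * (256 * ρ ^ 4 * (d * ∑' i, υ (i + 1)) ^ 4 + σ ^ 8) := by positivity
    nlinarith
  have hK0 : 0 ≤ K := by linarith
  set b : ℝ := inner ℝ β (trig j) with hb
  set γ := β - b • trig j with hγ
  let Z : L2I × ℝ → ℝ := fun x => inner ℝ x.1 (trig j) / √lam
  let U : L2I × ℝ → ℝ := fun x => inner ℝ x.1 γ + σ * x.2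
  have hZ : Measurable Z := ((measurable_inner_const _).comp measurable_fst).div_const _
  have hU : Measurable U :=
    ((measurable_inner_const _).comp measurable_fst).add (measurable_snd.const_mul _)
  have hsqrt : √lam ≠ 0 := (Real.sqrt_pos.2 hlpos).ne'
  -- Moments of the copies.
  have hz8 : ∀ i, ∫⁻ ω, ENNReal.ofReal (Z (Xs i ω, εs i ω) ^ 8) ∂P ≤ ENNReal.ofReal K := by
    intro i
    rw [hS.lintegral_eq (hZ.pow_const 8) i]
    have := hX.moment j hj
    rw [← hlam] at this
    exact (lintegral_pow_eight_le hr hη this).trans (ENNReal.ofReal_le_ofReal hKη)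
  have hu8 : ∀ i, ∫⁻ ω, ENNReal.ofReal (U (Xs i ω, εs i ω) ^ 8) ∂P ≤ ENNReal.ofReal K := by
    intro i
    rw [hS.lintegral_eq (hU.pow_const 8) i, hK]
    exact lintegral_residual_pow_eight_le hX hε hr hη hd hυ hs σ hβ hj
  have hz2 : ∀ i, ∫ ω, Z (Xs i ω, εs i ω) ^ 2 ∂P = 1 := by
    intro i
    rw [hS.integral_eq (hZ.pow_const 2) i]
    have h1 := hX.integral_inner_mul_inner hj (trig j)
    rw [inner_trig_of_one_le hj hj, if_pos rfl, mul_one, ← hlam] at h1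
    have h2 : ∀ ω, Z (X ω, ε ω) ^ 2 =
        (inner ℝ (X ω) (trig j) * inner ℝ (X ω) (trig j)) / lam := by
      intro ω
      simp only [Z]
      rw [div_pow, Real.sq_sqrt hlpos.le, sq]
    simp only [h2]
    rw [integral_div, h1, div_self hlpos.ne']
  have huz : ∀ i, ∫ ω, U (Xs i ω, εs i ω) * Z (Xs i ω, εs i ω) ∂P = 0 := by
    intro i
    refine (hS.integral_eq (hU.mul hZ) i).trans ?_
    have h1 := hX.integral_inner_mul_inner hj γ
    have hγ0 : (inner ℝ γ (trig j) : ℝ) = 0 := by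
      rw [hγ, inner_sub_left, inner_smul_left, inner_trig_of_one_le hj hj, ← hb]
      simp
    rw [hγ0, mul_zero] at h1
    have h2 := hS.uncorrelated (trig j)
    have hε2 : MemLp ε 2 P := by
      rw [memLp_two_iff_integrable_sq hε.measurable.aestronglyMeasurable]
      by_contra hc
      have := hε.variance_one
      rw [integral_undef hc] at this
      exact zero_ne_one this
    have hX2 : MemLp (fun ω => (inner ℝ (X ω) (trig j) : ℝ)) 2 P := hX.memLp.inner_const _
    have hi1 := (integrable_inner_mul_inner hX.memLp (trig j) γ).const_mul (1 / √lam)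
    have hi2 : Integrable (fun ω => σ / √lam * (ε ω * inner ℝ (X ω) (trig j))) P :=
      (hε2.integrable_mul hX2).const_mul (σ / √lam)
    have h3 : ∀ ω, U (X ω, ε ω) * Z (X ω, ε ω) =
        1 / √lam * (inner ℝ (X ω) (trig j) * inner ℝ (X ω) γ) +
          σ / √lam * (ε ω * inner ℝ (X ω) (trig j)) := by
      intro ω
      simp only [U, Z]
      ring
    simp only [Pi.mul_apply, h3]
    rw [integral_add hi1 hi2, integral_const_mul, integral_const_mul, h1, h2]
    simp
  obtain ⟨hA, hD, hDA⟩ := coefficient_deviation (z := fun i ω => Z (Xs i ω, εs i ω))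
    (u := fun i ω => U (Xs i ω, εs i ω)) hn (hS.aemeasurable hZ) (hS.aemeasurable hU)
    (hS.indep.comp (fun _ x => (Z x, U x)) fun _ => hZ.prodMk hU) hK0 hz8 hu8 hz2 huz
  set A := {ω | (1 / (n : ℝ)) * ∑ i, Z (Xs i ω, εs i ω) ^ 2 < 1 / 2} with hAdef
  set D : Ω → ℝ := fun ω => (1 / (n : ℝ)) * ∑ i, U (Xs i ω, εs i ω) * Z (Xs i ω, εs i ω) with hDdef
  set L : Ω → ℝ := fun ω => (1 / (n : ℝ)) * ∑ i, Z (Xs i ω, εs i ω) ^ 2 with hLdef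
  have hlhat : ∀ ω, lambdaHat (fun i => Xs i ω) j = lam * L ω := by
    intro ω
    simp only [lambdaHat, hLdef, Z, div_pow, Real.sq_sqrt hlpos.le, ← Finset.sum_div]
    field_simp
  have hghat : ∀ ω, gHat (fun i => Xs i ω) (fun i => inner ℝ β (Xs i ω) + σ * εs i ω) j =
      √lam * D ω + b * (lam * L ω) := by
    intro ω
    rw [← hlhat]
    simp only [gHat, lambdaHat, hDdef]
    rw [mul_left_comm (√lam), mul_left_comm b, ← mul_add]
    congr 1
    rw [Finset.mul_sum, Finset.mul_sum, ← Finset.sum_add_distrib]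
    refine Finset.sum_congr rfl fun i _ => ?_
    simp only [U, Z, hγ, inner_sub_right, inner_smul_right, real_inner_comm β]
    field_simp
    ring
  have hDm : AEMeasurable D P := (Finset.aemeasurable_fun_sum _ fun i _ =>
    (hS.aemeasurable hU i).mul (hS.aemeasurable hZ i)).const_mul _
  have hLm : AEMeasurable L P := (Finset.aemeasurable_fun_sum _ fun i _ =>
    (hS.aemeasurable hZ i).pow_const 2).const_mul _
  have hAm : NullMeasurableSet A P := nullMeasurableSet_lt hLm aemeasurable_const
  have hpt : ∀ ω, ENNReal.ofReal (((if α ≤ lambdaHat (fun i => Xs i ω) j then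
        gHat (fun i => Xs i ω) (fun i => inner ℝ β (Xs i ω) + σ * εs i ω) j /
          lambdaHat (fun i => Xs i ω) j else 0) - b) ^ 2) ≤
      ENNReal.ofReal (4 / lam) * ENNReal.ofReal (D ω ^ 2) +
        ENNReal.ofReal (lam / α ^ 2) * A.indicator (fun ω => ENNReal.ofReal (D ω ^ 2)) ω +
        {ω | lam * L ω < α}.indicator (fun _ => ENNReal.ofReal (b ^ 2)) ω := by
    intro ω
    rw [hlhat, hghat]
    refine (ENNReal.ofReal_le_ofReal (sq_coefficient_error_le hlpos hα)).trans ?_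
    refine ENNReal.ofReal_add_le.trans (add_le_add (ENNReal.ofReal_add_le.trans
      (add_le_add ?_ ?_)) ?_)
    · rw [ENNReal.ofReal_mul (by positivity)]
    · by_cases hω : L ω < 1 / 2
      · rw [if_pos hω, Set.indicator_of_mem (show ω ∈ A from hω),
          ENNReal.ofReal_mul (by positivity)]
      · rw [if_neg hω]; simp
    · by_cases hω : lam * L ω < α
      · rw [if_pos hω, Set.indicator_of_mem (show ω ∈ {ω | lam * L ω < α} from hω)]
      · rw [if_neg hω]; simp
  have hB : P {ω | lam * L ω < α} ≤
      ENNReal.ofReal (if 2 * α ≤ lam then Real.exp (-(n / (8 * (1 + K)))) else 1) := by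
    split_ifs with h
    · refine (measure_mono fun ω hω => ?_).trans hA
      change lam * L ω < α at hω
      change L ω < 1 / 2
      by_contra hc
      nlinarith [mul_le_mul_of_nonneg_left (not_lt.1 hc) hlpos.le]
    · simpa using prob_le_one
  have hm1 : AEMeasurable (fun ω => ENNReal.ofReal (D ω ^ 2)) P :=
    (hDm.pow_const 2).ennreal_ofReal
  have hm2 : AEMeasurable (fun ω => ENNReal.ofReal (4 / lam) * ENNReal.ofReal (D ω ^ 2) +
      ENNReal.ofReal (lam / α ^ 2) * A.indicator (fun ω => ENNReal.ofReal (D ω ^ 2)) ω) P :=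
    (hm1.const_mul _).add ((hm1.indicator₀ hAm).const_mul _)
  refine (lintegral_mono hpt).trans ?_
  rw [lintegral_add_left' hm2, lintegral_add_left' (hm1.const_mul _), lintegral_const_mul'' _ hm1,
    lintegral_const_mul'' _ (hm1.indicator₀ hAm)]
  have hexp : (0 : ℝ) ≤ if 2 * α ≤ lam then Real.exp (-(n / (8 * (1 + K)))) else 1 := by
    split_ifs <;> positivity
  rw [ENNReal.ofReal_add (by positivity) (by positivity), ENNReal.ofReal_add (by positivity)
    (by positivity), ENNReal.ofReal_mul (p := 4 / lam) (by positivity),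
    ENNReal.ofReal_mul (p := lam / α ^ 2) (by positivity),
    ENNReal.ofReal_mul (p := b ^ 2) (by positivity)]
  refine add_le_add (add_le_add ?_ ?_) ?_
  · gcongr
  · gcongr
    exact (lintegral_indicator_le _ _).trans hDA
  · exact (lintegral_indicator_const_le _ _).trans (mul_le_mul_right hB _)

end Coefficient

/-! ### The risk of the estimator for a balanced dimension -/

theorem inner_seriesEstimator_trig {n : ℕ} (m : ℕ) (α : ℝ) (x : Fin n → L2I) (y : Fin n → ℝ)
    {j : ℕ} (hj : 1 ≤ j) :
    (inner ℝ (seriesEstimator m α x y) (trig j) : ℝ) =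
      if j ≤ m then (if α ≤ lambdaHat x j then gHat x y j / lambdaHat x j else 0) else 0 := by
  rw [seriesEstimator, sum_inner]
  have h : ∀ i ∈ Finset.Icc 1 m,
      (inner ℝ ((if α ≤ lambdaHat x i then gHat x y i / lambdaHat x i else 0) • trig i)
        (trig j) : ℝ) =
      if i = j then (if α ≤ lambdaHat x j then gHat x y j / lambdaHat x j else 0) else 0 := by
    intro i hi
    rw [inner_smul_left, inner_trig_of_one_le (Finset.mem_Icc.1 hi).1 hj]
    split_ifs with h1 h2 h2 <;> simp_all
  rw [Finset.sum_congr rfl h, Finset.sum_ite_eq']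
  simp [hj]

theorem sobolevNormSq_seriesEstimator_lt_top {n : ℕ} (r : ℝ) (m : ℕ) (α : ℝ) (x : Fin n → L2I)
    (y : Fin n → ℝ) : sobolevNormSq r (seriesEstimator m α x y) < ∞ := by
  rw [sobolevNormSq, tsum_eq_sum (s := Finset.range m)]
  · exact ENNReal.sum_lt_top.2 fun i _ => ENNReal.ofReal_lt_top
  · intro i hi
    rw [inner_seriesEstimator_trig _ _ _ _ (by omega), if_neg (by simpa using hi)]
    simp

theorem sobolevWeight_eq_mul (p r : ℝ) {j : ℕ} (hj : 1 ≤ j) :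
    sobolevWeight p j = sobolevWeight r j * sobolevWeight (p - r) j := by
  unfold sobolevWeight
  split_ifs with h
  · simp
  · have : (0 : ℝ) < (j / 2 : ℕ) := by
      have : 0 < j / 2 := by omega
      exact_mod_cast this
    rw [← Real.rpow_add this]
    congr 1
    ring

theorem sobolevWeight_mono_right {r : ℝ} (hr : 0 ≤ r) {i j : ℕ} (hi : 1 ≤ i) (hij : i ≤ j) :
    sobolevWeight r i ≤ sobolevWeight r j := by
  rcases eq_or_lt_of_le hi with rfl | hi'
  · rw [sobolevWeight_one]
    exact one_le_sobolevWeight hr hij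
  · unfold sobolevWeight
    rw [if_neg (by omega), if_neg (by omega)]
    gcongr

/-- Truncation at `m` loses at most the fraction `w_m^s / w_m^p` of the Sobolev norm. -/
theorem sobolevWeight_le_ratio_mul {p s : ℝ} (hsp : s ≤ p) {m j : ℕ} (hm : 1 ≤ m) (hmj : m ≤ j) :
    sobolevWeight s j ≤ sobolevWeight s m / sobolevWeight p m * sobolevWeight p j := by
  have hj : 1 ≤ j := hm.trans hmj
  have h1 := sobolevWeight_pos s hm
  have h2 := sobolevWeight_pos (p - s) hm
  rw [sobolevWeight_eq_mul p s hm, sobolevWeight_eq_mul p s hj, ← div_div, div_self h1.ne',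
    div_mul_eq_mul_div, one_mul, le_div_iff₀ h2]
  exact mul_le_mul_of_nonneg_left (sobolevWeight_mono_right (by linarith) hm hmj)
    (sobolevWeight_pos s hj).le

theorem exp_neg_le_inv {x : ℝ} (hx : 0 < x) : Real.exp (-x) ≤ 1 / x := by
  rw [Real.exp_neg, ← one_div]
  exact one_div_le_one_div_of_le hx (by linarith [Real.add_one_le_exp x])

theorem exp_neg_le_inv_cube {x : ℝ} (hx : 0 < x) : Real.exp (-x) ≤ 6 / x ^ 3 := by
  have h := Real.pow_div_factorial_le_exp x hx.le 3
  rw [Real.exp_neg, ← one_div, show 6 / x ^ 3 = 1 / (x ^ 3 / 6) by field_simp]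
  refine one_div_le_one_div_of_le (by positivity) ?_
  simpa [Nat.factorial] using h

/-- The bound for one coefficient, rewritten for a threshold `α ∼ 1 / n` and a balanced dimension:
`R` stands for `w_m^s / w_m^p`, `ws` and `wp` for `w_j^s` and `w_j^p`, `ν` for `υ_j`. In the case
`lam < 2 α` the balance condition makes `ws` small. -/
theorem weighted_coefficient_bound {κ d c₁ c₂ Δ R ws wp ν lam α b N : ℝ} (hκ : 0 < κ)
    (hd : 1 ≤ d) (hc₁ : 0 < c₁) (hc₂ : 0 < c₂) (hΔ : 1 ≤ Δ) (hR : 0 < R) (hws : 0 < ws)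
    (hwp : ws ≤ wp) (hwp1 : 1 ≤ wp) (hν : 0 < ν) (hν1 : ν ≤ 1) (hlam : ν / d ≤ lam)
    (hlam' : lam ≤ d * ν)
    (hN : 0 < N) (hα : c₁ / N ≤ α) (hα' : α ≤ c₂ / N) (hbal : ws / ν ≤ Δ * N * R)
    (hbal1 : 1 ≤ Δ * N * R) :
    ws * (4 / lam * (κ / N) + lam / α ^ 2 * (κ * Real.exp (-(N / (16 * κ)))) +
        b ^ 2 * if 2 * α ≤ lam then Real.exp (-(N / (8 * κ))) else 1) ≤
      (4 * κ * d + 6 * d * κ * (16 * κ) ^ 3 / c₁ ^ 2) / N * (ws / ν) +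
        (8 * κ * Δ + 2 * d * c₂ * Δ) * R * (wp * b ^ 2) := by
  have hd0 : 0 < d := by linarith
  have hlpos : 0 < lam := (div_pos hν hd0).trans_le hlam
  have hαpos : 0 < α := (div_pos hc₁ hN).trans_le hα
  have hΔ0 : 0 < Δ := by linarith
  have h1 : 4 / lam * (κ / N) ≤ 4 * κ * d / N * (1 / ν) := by
    calc 4 / lam * (κ / N) ≤ 4 / (ν / d) * (κ / N) := by gcongr
      _ = _ := by field_simp
  have h2 : lam / α ^ 2 * (κ * Real.exp (-(N / (16 * κ)))) ≤
      6 * d * κ * (16 * κ) ^ 3 / c₁ ^ 2 / N * (1 / ν) := by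
    calc lam / α ^ 2 * (κ * Real.exp (-(N / (16 * κ))))
        ≤ d * ν / (c₁ / N) ^ 2 * (κ * (6 / (N / (16 * κ)) ^ 3)) := by
          gcongr
          exact exp_neg_le_inv_cube (by positivity)
      _ = 6 * d * κ * (16 * κ) ^ 3 / c₁ ^ 2 / N * ν := by field_simp
      _ ≤ _ := by
          have : ν ≤ 1 / ν := hν1.trans (one_le_one_div hν hν1)
          gcongr
  have h3 : ws * (b ^ 2 * if 2 * α ≤ lam then Real.exp (-(N / (8 * κ))) else 1) ≤
      (8 * κ * Δ + 2 * d * c₂ * Δ) * R * (wp * b ^ 2) := by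
    have hwp0 : 0 < wp := hws.trans_le hwp
    split_ifs with h
    · have h4 : Real.exp (-(N / (8 * κ))) ≤ 8 * κ * Δ * R := by
        calc Real.exp (-(N / (8 * κ))) ≤ 1 / (N / (8 * κ)) := exp_neg_le_inv (by positivity)
          _ = 8 * κ / N * 1 := by field_simp
          _ ≤ 8 * κ / N * (Δ * N * R) := by gcongr
          _ = _ := by field_simp
      calc ws * (b ^ 2 * Real.exp (-(N / (8 * κ)))) ≤ wp * (b ^ 2 * (8 * κ * Δ * R)) := by gcongr
        _ = 8 * κ * Δ * R * (wp * b ^ 2) := by ring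
        _ ≤ _ := by
          have : 0 ≤ 2 * d * c₂ * Δ * R * (wp * b ^ 2) := by positivity
          linarith
    · have h4 : ν ≤ 2 * d * c₂ / N := by
        have : ν / d ≤ 2 * (c₂ / N) := by linarith [not_le.1 h]
        rw [div_le_iff₀ hd0] at this
        calc ν ≤ 2 * (c₂ / N) * d := this
          _ = _ := by ring
      have h5 : ws ≤ 2 * d * c₂ * Δ * R := by
        rw [div_le_iff₀ hν] at hbal
        calc ws ≤ Δ * N * R * ν := hbal
          _ ≤ Δ * N * R * (2 * d * c₂ / N) := by gcongr
          _ = _ := by field_simp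
      calc ws * (b ^ 2 * 1) = ws * (1 * b ^ 2) := by ring
        _ ≤ 2 * d * c₂ * Δ * R * (wp * b ^ 2) := by gcongr
        _ ≤ _ := by
          have : 0 ≤ 8 * κ * Δ * R * (wp * b ^ 2) := by positivity
          linarith
  calc _ = ws * (4 / lam * (κ / N) + lam / α ^ 2 * (κ * Real.exp (-(N / (16 * κ))))) +
        ws * (b ^ 2 * if 2 * α ≤ lam then Real.exp (-(N / (8 * κ))) else 1) := by ring
    _ ≤ ws * (4 * κ * d / N * (1 / ν) + 6 * d * κ * (16 * κ) ^ 3 / c₁ ^ 2 / N * (1 / ν)) +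
        (8 * κ * Δ + 2 * d * c₂ * Δ) * R * (wp * b ^ 2) := by gcongr
    _ = _ := by ring

/-- The risk is of order `w_m^s / w_m^p` as soon as the threshold is of order `1 / n` and the
dimension is balanced; the constant depends on the weights only through their sum. -/
theorem exists_iSup_derivRisk_le {υ : ℕ → ℝ} {p : ℝ} {s : ℕ} (hsp : (s : ℝ) ≤ p)
    {ρ σ d η c₁ c₂ Δ : ℝ} (hρ : 0 < ρ) (hd : 1 ≤ d) (hη : 1 ≤ η) (hc₁ : 0 < c₁) (hc₂ : 0 < c₂)
    (hΔ : 1 ≤ Δ) (hυ : ∀ j, 1 ≤ j → 0 < υ j) (hυ1 : ∀ j, 1 ≤ j → υ j ≤ 1) (hυone : υ 1 = 1)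
    (hs : Summable fun i => υ (i + 1)) :
    ∃ C : ℝ, 0 < C ∧ ∀ (n m : ℕ) (α : ℝ), 0 < n → 1 ≤ m → c₁ / n ≤ α → α ≤ c₂ / n →
      sobolevWeight p m / ((n : ℝ) * sobolevWeight s m) *
        ∑ j ∈ Finset.Icc 1 m, sobolevWeight s j / υ j ≤ Δ →
      ∀ (Ω : Type u) [MeasurableSpace Ω] (P : Measure Ω) [IsProbabilityMeasure P]
        (r : ℕ) (X : Ω → L2I) (ε : Ω → ℝ) (Xs : Fin n → Ω → L2I) (εs : Fin n → Ω → ℝ),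
        8 ≤ r → IsRegressor P υ d η r X → IsErrorTerm P η r ε → IsSample P X ε Xs εs →
        ⨆ β ∈ sobolevEllipsoid p ρ, derivRisk P Xs εs σ s m α β
          ≤ ENNReal.ofReal (C * (sobolevWeight s m / sobolevWeight p m)) := by
  have hd0 : 0 < d := by linarith
  set K := momentBound ρ σ η (d * ∑' i, υ (i + 1)) with hK
  have hM0 : 0 ≤ d * ∑' i, υ (i + 1) :=
    mul_nonneg hd0.le (tsum_nonneg fun i => (hυ _ (by omega)).le)
  have hK0 : 0 ≤ K := by rw [hK, momentBound]; positivity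
  have hκ : 0 < 1 + K := by linarith
  set C₁ := 4 * (1 + K) * d + 6 * d * (1 + K) * (16 * (1 + K)) ^ 3 / c₁ ^ 2 with hC₁
  set C₂ := 8 * (1 + K) * Δ + 2 * d * c₂ * Δ with hC₂
  have hC₁0 : 0 < C₁ := by positivity
  have hC₂0 : 0 < C₂ := by positivity
  refine ⟨(2 * Real.pi) ^ (2 * s) * (C₁ * Δ + (C₂ + 1) * ρ), by positivity, ?_⟩
  intro n m α hn hm hα hα' hbal Ω _ P _ r X ε Xs εs hr hX hε hS
  have hN : (0 : ℝ) < n := by exact_mod_cast hn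
  have hαpos : 0 < α := (div_pos hc₁ hN).trans_le hα
  have hwm := sobolevWeight_pos (s : ℝ) hm
  have hwpm := sobolevWeight_pos p hm
  set R := sobolevWeight s m / sobolevWeight p m with hR
  have hR0 : 0 < R := div_pos hwm hwpm
  have hsum : ∑ j ∈ Finset.Icc 1 m, sobolevWeight s j / υ j ≤ Δ * n * R := by
    rw [div_mul_eq_mul_div, div_le_iff₀ (by positivity)] at hbal
    rw [hR, ← mul_div_assoc, le_div_iff₀ hwpm]
    linarith
  have hterm : ∀ j ∈ Finset.Icc 1 m, sobolevWeight s j / υ j ≤ Δ * n * R := fun j hj =>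
    (Finset.single_le_sum (f := fun j => sobolevWeight s j / υ j) (fun i hi =>
      (div_pos (sobolevWeight_pos _ (Finset.mem_Icc.1 hi).1) (hυ i (Finset.mem_Icc.1 hi).1)).le)
      hj).trans hsum
  have hone : 1 ≤ Δ * n * R := by
    have := hterm 1 (by simp [hm])
    rwa [sobolevWeight_one, hυone, div_one] at this
  refine iSup₂_le fun β hβ => ?_
  have hβ' : sobolevNormSq p β ≤ ENNReal.ofReal ρ := hβ
  have hβfin : sobolevNormSq s β < ∞ :=
    (sobolevNormSq_mono hsp β).trans_lt (hβ'.trans_lt ENNReal.ofReal_lt_top)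
  have hβnorm : ‖β‖ ^ 2 ≤ ρ := by
    have h0 := sobolevNormSq_mono ((Nat.cast_nonneg s).trans hsp) β
    rw [sobolevNormSq_zero] at h0
    exact (ENNReal.ofReal_le_ofReal_iff hρ.le).1 (h0.trans hβ')
  set est : Ω → L2I := fun ω => seriesEstimator m α (fun i => Xs i ω)
    (fun i => inner ℝ β (Xs i ω) + σ * εs i ω) with hest
  have hp0 : (0 : ℝ) ≤ p := (Nat.cast_nonneg s).trans hsp
  have hmeas : ∀ i : ℕ, AEMeasurable (fun ω => ENNReal.ofReal (sobolevWeight s (i + 1) *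
      (inner ℝ (est ω - β) (trig (i + 1)) : ℝ) ^ 2)) P := by
    intro i
    simp only [inner_sub_left, hest, inner_seriesEstimator_trig _ _ _ _ (Nat.le_add_left 1 i)]
    have hl : AEMeasurable (fun ω => lambdaHat (fun i => Xs i ω) (i + 1)) P :=
      (Finset.aemeasurable_fun_sum _ fun k _ => hS.aemeasurable
        (((measurable_inner_const (trig (i + 1))).comp measurable_fst).pow_const 2) k).const_mul _
    have hg : AEMeasurable (fun ω => gHat (fun i => Xs i ω)
        (fun i => inner ℝ β (Xs i ω) + σ * εs i ω) (i + 1)) P := by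
      refine (Finset.aemeasurable_fun_sum _ fun k _ => ?_).const_mul _
      simp only [real_inner_comm _ β]
      exact hS.aemeasurable ((((measurable_inner_const β).comp measurable_fst).add
        (measurable_snd.const_mul σ)).mul
          ((measurable_inner_const (trig (i + 1))).comp measurable_fst)) k
    have hG : Measurable fun x : ℝ × ℝ => if α ≤ x.1 then x.2 / x.1 else 0 :=
      Measurable.ite (measurableSet_le measurable_const measurable_fst)
        (measurable_snd.div measurable_fst) measurable_const
    have hc := hG.comp_aemeasurable (hl.prodMk hg)
    split_ifs
    · exact (((hc.sub aemeasurable_const).pow_const 2).const_mul _).ennreal_ofReal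
    · exact aemeasurable_const
  have hcoef : ∀ i : ℕ, ∫⁻ ω, ENNReal.ofReal (sobolevWeight s (i + 1) *
        (inner ℝ (est ω - β) (trig (i + 1)) : ℝ) ^ 2) ∂P ≤
      (if i ∈ Finset.range m then
        ENNReal.ofReal (C₁ / n * (sobolevWeight s (i + 1) / υ (i + 1))) else 0) +
      ENNReal.ofReal ((C₂ + 1) * R) * ENNReal.ofReal (sobolevWeight p (i + 1) *
        (inner ℝ β (trig (i + 1)) : ℝ) ^ 2) := by
    intro i
    have hi : 1 ≤ i + 1 := by omega
    have hws := sobolevWeight_pos (s : ℝ) hi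
    have hwp := sobolevWeight_pos p hi
    rw [← ENNReal.ofReal_mul (by positivity)]
    simp only [inner_sub_left, hest, inner_seriesEstimator_trig _ _ _ _ hi]
    by_cases him : i + 1 ≤ m
    · rw [if_pos (Finset.mem_range.2 him)]
      simp only [if_pos him]
      have hb := lintegral_coefficient_error_le hX hε hS hr (by linarith) hd0 hυ hs σ hβnorm hi hn
        hαpos hK rfl
      simp only [ENNReal.ofReal_mul hws.le]
      rw [lintegral_const_mul' _ _ ENNReal.ofReal_ne_top]
      refine (mul_le_mul_right hb _).trans ?_
      have hυi := hυ _ hi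
      rw [← ENNReal.ofReal_mul hws.le, ← ENNReal.ofReal_add (by positivity) (by positivity)]
      refine ENNReal.ofReal_le_ofReal ((weighted_coefficient_bound hκ hd hc₁ hc₂ hΔ hR0 hws
        (sobolevWeight_mono_left hsp hi) (one_le_sobolevWeight hp0 hi) hυi (hυ1 _ hi)
        (hX.le_trigEigenvalue hi hυi) (hX.trigEigenvalue_le hi hυi) hN hα hα'
        (hterm _ (Finset.mem_Icc.2 ⟨hi, him⟩)) hone).trans ?_)
      rw [← hC₁, ← hC₂]
      gcongr
      linarith
    · rw [if_neg (by simpa using him), zero_add]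
      simp only [if_neg him, zero_sub, neg_sq]
      rw [lintegral_const, measure_univ, mul_one]
      refine ENNReal.ofReal_le_ofReal ?_
      have h1 := sobolevWeight_le_ratio_mul hsp hm (by omega : m ≤ i + 1)
      calc sobolevWeight s (i + 1) * (inner ℝ β (trig (i + 1)) : ℝ) ^ 2
          ≤ R * sobolevWeight p (i + 1) * (inner ℝ β (trig (i + 1)) : ℝ) ^ 2 := by gcongr
        _ = 1 * R * (sobolevWeight p (i + 1) * (inner ℝ β (trig (i + 1)) : ℝ) ^ 2) := by ring
        _ ≤ _ := by gcongr; linarith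
  calc derivRisk P Xs εs σ s m α β
      ≤ ∫⁻ ω, ENNReal.ofReal ((2 * Real.pi) ^ (2 * s)) * sobolevNormSq s (est ω - β) ∂P :=
        lintegral_mono fun ω => enorm_weakDeriv_sub_sq_le s
          (sobolevNormSq_seriesEstimator_lt_top _ _ _ _ _) hβfin
    _ = ENNReal.ofReal ((2 * Real.pi) ^ (2 * s)) * ∑' i, ∫⁻ ω, ENNReal.ofReal
          (sobolevWeight s (i + 1) * (inner ℝ (est ω - β) (trig (i + 1)) : ℝ) ^ 2) ∂P := by
        rw [lintegral_const_mul' _ _ ENNReal.ofReal_ne_top]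
        simp only [sobolevNormSq]
        rw [lintegral_tsum hmeas]
    _ ≤ ENNReal.ofReal ((2 * Real.pi) ^ (2 * s)) *
        ∑' i, ((if i ∈ Finset.range m then
          ENNReal.ofReal (C₁ / n * (sobolevWeight s (i + 1) / υ (i + 1))) else 0) +
          ENNReal.ofReal ((C₂ + 1) * R) * ENNReal.ofReal (sobolevWeight p (i + 1) *
            (inner ℝ β (trig (i + 1)) : ℝ) ^ 2)) := by
        gcongr with i
        exact hcoef i
    _ ≤ ENNReal.ofReal ((2 * Real.pi) ^ (2 * s)) *
        (ENNReal.ofReal (C₁ * Δ * R) + ENNReal.ofReal ((C₂ + 1) * R) * ENNReal.ofReal ρ) := by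
        rw [ENNReal.tsum_add, ENNReal.tsum_mul_left]
        gcongr
        · rw [tsum_eq_sum (s := Finset.range m) (fun i hi => if_neg hi),
            Finset.sum_congr rfl (fun i hi => if_pos hi), ← ENNReal.ofReal_sum_of_nonneg]
          · refine ENNReal.ofReal_le_ofReal ?_
            rw [← Finset.mul_sum, Finset.range_eq_Ico, Finset.sum_Ico_add'
              (fun j => sobolevWeight s j / υ j) 0 m 1]
            calc C₁ / n * ∑ j ∈ Finset.Ico (0 + 1) (m + 1), sobolevWeight s j / υ j
                ≤ C₁ / n * (Δ * n * R) := by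
                  gcongr
                  exact hsum
              _ = C₁ * Δ * R := by field_simp
          · intro i _
            have := sobolevWeight_pos (s : ℝ) (Nat.le_add_left 1 i)
            have := hυ _ (Nat.le_add_left 1 i)
            positivity
        · exact hβ'
    _ = _ := by
        rw [← ENNReal.ofReal_mul (by positivity), ← ENNReal.ofReal_add (by positivity)
          (by positivity), ← ENNReal.ofReal_mul (by positivity)]
        congr 1
        ring

/-! ### Rates -/

theorem sobolevWeight_le_rpow {r : ℝ} (hr : 0 ≤ r) (m : ℕ) :
    sobolevWeight r m ≤ (m : ℝ) ^ (2 * r) := by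
  unfold sobolevWeight
  split_ifs with h
  · simp [h]
  · gcongr
    exact Nat.div_le_self m 2

theorem rpow_le_sobolevWeight {r : ℝ} (hr : 0 ≤ r) {m : ℕ} (hm : 1 ≤ m) :
    ((m : ℝ) / 3) ^ (2 * r) ≤ sobolevWeight r m := by
  unfold sobolevWeight
  split_ifs with h
  · exact Real.rpow_le_one (by positivity) (by rw [h]; norm_num) (by positivity)
  · gcongr
    rw [div_le_iff₀ (by norm_num)]
    have : m ≤ m / 2 * 3 := by omega
    exact_mod_cast this

/-- The order of `w_m^s / w_m^p` for a dimension of order at least `b`. -/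
theorem eventually_sobolevWeight_ratio_le {p : ℝ} {s : ℕ} (hsp : (s : ℝ) ≤ p) {m : ℕ → ℕ}
    {b : ℕ → ℝ} (hb : ∀ᶠ n in atTop, 0 < b n) (hbm : RateLE b fun n => (m n : ℝ)) :
    (∀ᶠ n in atTop, 1 ≤ m n) ∧
    ∃ C : ℝ, 0 < C ∧ ∀ᶠ n in atTop,
      sobolevWeight s (m n) / sobolevWeight p (m n) ≤ C * b n ^ (-(2 * (p - s))) := by
  obtain ⟨C, hC, h⟩ := hbm
  have hm : ∀ᶠ n in atTop, 1 ≤ m n := by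
    filter_upwards [hb, h] with n h1 h2
    have : (0 : ℝ) < m n := pos_of_mul_pos_right (h1.trans_le h2) hC.le
    exact_mod_cast this
  refine ⟨hm, (3 * C) ^ (2 * (p - s)), by positivity, ?_⟩
  filter_upwards [hb, h, hm] with n h1 h2 h3
  have hps : 0 ≤ p - s := by linarith
  have hw := sobolevWeight_pos (s : ℝ) h3
  rw [sobolevWeight_eq_mul p s h3, ← div_div, div_self hw.ne']
  have h4 : (b n / (3 * C)) ^ (2 * (p - s)) ≤ sobolevWeight (p - s) (m n) := by
    refine le_trans (Real.rpow_le_rpow (by positivity) ?_ (by positivity))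
      (rpow_le_sobolevWeight hps h3)
    rw [div_le_div_iff₀ (by positivity) (by norm_num)]
    linarith
  calc 1 / sobolevWeight (p - s) (m n) ≤ 1 / (b n / (3 * C)) ^ (2 * (p - s)) := by gcongr
    _ = _ := by
      rw [Real.div_rpow h1.le (by positivity), Real.rpow_neg h1.le]
      field_simp

theorem hasUpperRate_of_varianceBalanced {υ : ℕ → ℝ} {p : ℝ} {s : ℕ} (hsp : (s : ℝ) ≤ p)
    {ρ σ d η : ℝ} (hρ : 0 < ρ) (hd : 1 ≤ d) (hη : 1 ≤ η)
    (hυ : ∀ j, 1 ≤ j → 0 < υ j) (hυ1 : ∀ j, 1 ≤ j → υ j ≤ 1) (hυone : υ 1 = 1)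
    (hs : Summable fun i => υ (i + 1)) {m : ℕ → ℕ} {α : ℕ → ℝ} {b rate : ℕ → ℝ}
    (hb : ∀ᶠ n in atTop, 0 < b n) (hbm : RateLE b fun n => (m n : ℝ))
    (hrate : ∀ᶠ n in atTop, b n ^ (-(2 * (p - s))) = rate n)
    (hbal : VarianceBalanced υ p s m) (hα : RateEq α fun n => 1 / (n : ℝ)) :
    HasUpperRate.{u} υ p s ρ σ d η m α rate := by
  obtain ⟨hm, C', hC', hratio⟩ := eventually_sobolevWeight_ratio_le hsp hb hbm
  obtain ⟨Δ, hΔ, hbal⟩ := hbal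
  obtain ⟨⟨c₂, hc₂, hα₂⟩, ⟨c, hc, hα₁⟩⟩ := hα
  obtain ⟨C, hC, hrisk⟩ := exists_iSup_derivRisk_le.{u} hsp (σ := σ) (c₁ := 1 / c) hρ hd hη
    (by positivity) hc₂ hΔ hυ hυ1 hυone hs
  obtain ⟨N, hN⟩ := eventually_atTop.1
    ((hm.and (hratio.and (hbal.and (hα₂.and (hα₁.and hrate))))).and (eventually_gt_atTop 0))
  refine ⟨C * C', by positivity, N, ?_⟩
  intro n hn Ω _ P _ k X ε Xs εs hk hX hε hS
  obtain ⟨⟨h1, h2, h3, h4, h5, h6⟩, h0⟩ := hN n hn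
  refine (hrisk n (m n) (α n) h0 h1 ?_ ?_ h3 Ω P (4 * k) X ε Xs εs (by omega) hX hε hS).trans ?_
  · rw [div_div, mul_comm c, ← div_div, div_le_iff₀ hc]
    linarith
  · rwa [mul_one_div] at h4
  · refine ENNReal.ofReal_le_ofReal ?_
    rw [mul_assoc, ← h6]
    gcongr

theorem balance_le {υ : ℕ → ℝ} {p : ℝ} {s : ℕ} (hp : 0 ≤ p) (hυ : ∀ j, 1 ≤ j → 0 < υ j)
    {n m : ℕ} (hn : 0 < n) (hm : 1 ≤ m) {V : ℝ} (hV : ∀ j, 1 ≤ j → j ≤ m → 1 / υ j ≤ V) :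
    sobolevWeight p m / ((n : ℝ) * sobolevWeight s m) *
      ∑ j ∈ Finset.Icc 1 m, sobolevWeight s j / υ j ≤ (m : ℝ) ^ (2 * p + 1) * V / n := by
  have hn' : (0 : ℝ) < n := by exact_mod_cast hn
  have hm' : (0 : ℝ) < m := by exact_mod_cast hm
  have hws := sobolevWeight_pos (s : ℝ) hm
  have hwp := sobolevWeight_pos p hm
  have hV0 : 0 < V := (one_div_pos.2 (hυ 1 le_rfl)).trans_le (hV 1 le_rfl hm)
  have hsum : ∑ j ∈ Finset.Icc 1 m, sobolevWeight s j / υ j ≤ m * (sobolevWeight s m * V) := by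
    calc _ ≤ ∑ _j ∈ Finset.Icc 1 m, sobolevWeight s m * V := by
          refine Finset.sum_le_sum fun j hj => ?_
          obtain ⟨h1, h2⟩ := Finset.mem_Icc.1 hj
          rw [div_eq_mul_one_div]
          have := hυ j h1
          gcongr
          · exact sobolevWeight_mono_right (Nat.cast_nonneg s) h1 h2
          · exact hV j h1 h2
      _ = _ := by simp
  calc _ ≤ sobolevWeight p m / ((n : ℝ) * sobolevWeight s m) * (m * (sobolevWeight s m * V)) := by
        gcongr
    _ = sobolevWeight p m * m * V / n := by field_simp
    _ ≤ (m : ℝ) ^ (2 * p) * m * V / n := by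
        gcongr
        exact sobolevWeight_le_rpow hp m
    _ = _ := by rw [Real.rpow_add hm', Real.rpow_one]

/-! ### Polynomial weights -/

theorem polyWeight_eq (a : ℝ) {j : ℕ} : polyWeight a j = (j : ℝ) ^ (-2 * a) := by
  unfold polyWeight
  split_ifs with h
  · simp [h]
  · rfl

theorem polyWeight_pos (a : ℝ) {j : ℕ} (hj : 1 ≤ j) : 0 < polyWeight a j := by
  rw [polyWeight_eq]
  positivity

theorem polyWeight_le_one {a : ℝ} (ha : 0 ≤ a) {j : ℕ} (hj : 1 ≤ j) : polyWeight a j ≤ 1 := by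
  rw [polyWeight_eq]
  exact Real.rpow_le_one_of_one_le_of_nonpos (by exact_mod_cast hj) (by linarith)

theorem summable_polyWeight {a : ℝ} (ha : 1 / 2 < a) :
    Summable fun i => polyWeight a (i + 1) := by
  simp only [polyWeight_eq]
  exact (summable_nat_add_iff 1).2 (Real.summable_nat_rpow.2 (by linarith))

theorem varianceBalanced_polyWeight {p a : ℝ} {s : ℕ} (hp : 0 ≤ p) (ha : 0 ≤ a) {m : ℕ → ℕ}
    (hm1 : ∀ᶠ n in atTop, 1 ≤ m n)
    (hm : RateLE (fun n => (m n : ℝ)) fun n => (n : ℝ) ^ (1 / (2 * p + 2 * a + 1))) :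
    VarianceBalanced (polyWeight a) p s m := by
  obtain ⟨C, hC, h⟩ := hm
  refine ⟨max 1 (C ^ (2 * p + 2 * a + 1)), le_max_left _ _, ?_⟩
  filter_upwards [h, hm1, eventually_gt_atTop 0] with n h1 h2 hn
  have hn' : (0 : ℝ) < n := by exact_mod_cast hn
  have hm' : (0 : ℝ) < m n := by exact_mod_cast h2
  have hD : 0 < 2 * p + 2 * a + 1 := by linarith
  refine (balance_le hp (fun j hj => polyWeight_pos a hj) hn h2
    (V := (m n : ℝ) ^ (2 * a)) fun j hj hjm => ?_).trans ((?_ : _ ≤ _).trans (le_max_right _ _))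
  · rw [polyWeight_eq, one_div, ← Real.rpow_neg (by positivity), neg_mul, neg_neg]
    gcongr
  · rw [← Real.rpow_add hm', div_le_iff₀ hn', show 2 * p + 1 + 2 * a = 2 * p + 2 * a + 1 by ring]
    calc (m n : ℝ) ^ (2 * p + 2 * a + 1)
        ≤ (C * (n : ℝ) ^ (1 / (2 * p + 2 * a + 1))) ^ (2 * p + 2 * a + 1) := by gcongr
      _ = _ := by
        rw [Real.mul_rpow hC.le (by positivity), ← Real.rpow_mul hn'.le, one_div,
          inv_mul_cancel₀ hD.ne', Real.rpow_one]

/-! ### Exponential weights -/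

theorem expWeight_pos (a : ℝ) (j : ℕ) : 0 < expWeight a j := by
  unfold expWeight
  split_ifs <;> positivity

theorem expWeight_le_one (a : ℝ) (j : ℕ) : expWeight a j ≤ 1 := by
  unfold expWeight
  split_ifs
  · exact le_rfl
  · rw [Real.exp_le_one_iff, neg_nonpos]
    positivity

theorem one_div_expWeight_le {a : ℝ} (ha : 0 ≤ a) {j m : ℕ} (hjm : j ≤ m) :
    1 / expWeight a j ≤ Real.exp ((m : ℝ) ^ (2 * a)) := by
  unfold expWeight
  split_ifs
  · rw [div_one]
    exact Real.one_le_exp (by positivity)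
  · rw [one_div, ← Real.exp_neg, neg_neg]
    gcongr

theorem summable_expWeight {a : ℝ} (ha : 0 < a) : Summable fun i => expWeight a (i + 1) := by
  -- `exp (-x) ≤ N! x ^ (-N)` with `x = j ^ (2 a)`, where `a N ≥ 1`.
  obtain ⟨N, hN⟩ := exists_nat_ge (1 / a)
  rw [div_le_iff₀ ha] at hN
  have hs : Summable fun i : ℕ => (N.factorial : ℝ) * ((i + 1 : ℕ) : ℝ) ^ (-2 : ℝ) :=
    ((summable_nat_add_iff 1).2 (Real.summable_nat_rpow.2 (by norm_num))).mul_left _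
  refine hs.of_nonneg_of_le (fun i => (expWeight_pos a _).le) fun i => ?_
  have hfac : (0 : ℝ) < N.factorial := by exact_mod_cast N.factorial_pos
  have hj : (1 : ℝ) ≤ ((i + 1 : ℕ) : ℝ) := by exact_mod_cast Nat.le_add_left 1 i
  unfold expWeight
  split_ifs with h
  · rw [h, Nat.cast_one, Real.one_rpow, mul_one]
    exact_mod_cast N.factorial_pos
  · set x : ℝ := ((i + 1 : ℕ) : ℝ) ^ (2 * a) with hx
    have hx0 : 0 < x := by positivity
    have h1 := Real.pow_div_factorial_le_exp x hx0.le N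
    have h2 : ((i + 1 : ℕ) : ℝ) ^ (2 : ℝ) ≤ x ^ N := by
      rw [hx, ← Real.rpow_natCast, ← Real.rpow_mul (by positivity)]
      exact Real.rpow_le_rpow_of_exponent_le hj (by linarith)
    rw [Real.exp_neg, Real.rpow_neg (by positivity), ← div_eq_mul_inv,
      ← inv_div _ (N.factorial : ℝ)]
    gcongr
    exact le_trans (by gcongr) h1

theorem exists_varianceBalanced_expWeight {p a : ℝ} (s : ℕ) (hp : 0 ≤ p) (ha : 0 < a) :
    ∃ m : ℕ → ℕ,
      RateEq (fun n => (m n : ℝ)) (fun n => Real.log n ^ (1 / (2 * a))) ∧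
      VarianceBalanced (expWeight a) p s m := by
  -- With this dimension, `exp (m ^ (2 a))` is at most `√n`.
  set x : ℕ → ℝ := fun n => (Real.log n / 2) ^ (1 / (2 * a)) with hx
  have hlog : Tendsto (fun n : ℕ => Real.log n) atTop atTop :=
    Real.tendsto_log_atTop.comp tendsto_natCast_atTop_atTop
  have hx1 : ∀ᶠ n in atTop, 1 ≤ x n := by
    filter_upwards [hlog.eventually_ge_atTop 2] with n hn
    exact Real.one_le_rpow (by linarith) (by positivity)
  refine ⟨fun n => ⌊x n⌋₊, ⟨⟨1, one_pos, ?_⟩, ⟨2 * 2 ^ (1 / (2 * a)), by positivity, ?_⟩⟩,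
    1, le_rfl, ?_⟩
  · filter_upwards [hlog.eventually_ge_atTop 0] with n hn
    rw [one_mul]
    refine (Nat.floor_le (by positivity)).trans ?_
    exact Real.rpow_le_rpow (by positivity) (by linarith) (by positivity)
  · filter_upwards [hx1, hlog.eventually_ge_atTop 0] with n h1 hn
    have h2 : x n ≤ 2 * (⌊x n⌋₊ : ℝ) := by
      have h3 := Nat.lt_floor_add_one (x n)
      have h4 : (1 : ℝ) ≤ ⌊x n⌋₊ := by exact_mod_cast Nat.one_le_floor_iff (x n) |>.2 h1
      linarith
    calc Real.log n ^ (1 / (2 * a)) = (2 * (Real.log n / 2)) ^ (1 / (2 * a)) := by ring_nf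
      _ = 2 ^ (1 / (2 * a)) * x n := Real.mul_rpow (by norm_num) (by positivity)
      _ ≤ 2 ^ (1 / (2 * a)) * (2 * (⌊x n⌋₊ : ℝ)) := by gcongr
      _ = _ := by ring
  · have ho := (isLittleO_log_rpow_rpow_atTop ((2 * p + 1) / (2 * a))
      (by norm_num : (0 : ℝ) < 1 / 2)).comp_tendsto tendsto_natCast_atTop_atTop
    have hb := ho.bound one_pos
    filter_upwards [hx1, hlog.eventually_ge_atTop 0, hb, eventually_gt_atTop 0] with n h1 hl h2 hn
    have hn' : (0 : ℝ) < n := by exact_mod_cast hn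
    have hm1 : 1 ≤ ⌊x n⌋₊ := (Nat.one_le_floor_iff (x n)).2 h1
    have hfloor : (⌊x n⌋₊ : ℝ) ≤ x n := Nat.floor_le (by positivity)
    refine (balance_le hp (fun j _ => expWeight_pos a j) hn hm1
      fun j _ hjm => one_div_expWeight_le ha.le hjm).trans ?_
    rw [div_le_one hn']
    have hexp : Real.exp ((⌊x n⌋₊ : ℝ) ^ (2 * a)) ≤ (n : ℝ) ^ (1 / 2 : ℝ) := by
      rw [Real.rpow_def_of_pos hn']
      gcongr
      calc (⌊x n⌋₊ : ℝ) ^ (2 * a) ≤ x n ^ (2 * a) := by gcongr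
        _ = Real.log n / 2 := by
          rw [hx, ← Real.rpow_mul (by positivity), one_div, inv_mul_cancel₀ (by positivity),
            Real.rpow_one]
        _ = _ := by ring
    have hpow : (⌊x n⌋₊ : ℝ) ^ (2 * p + 1) ≤ (n : ℝ) ^ (1 / 2 : ℝ) := by
      simp only [Function.comp_apply, one_mul, Real.norm_eq_abs] at h2
      rw [abs_of_nonneg (by positivity), abs_of_nonneg (by positivity)] at h2
      refine le_trans ?_ h2
      calc (⌊x n⌋₊ : ℝ) ^ (2 * p + 1) ≤ (Real.log n ^ (1 / (2 * a))) ^ (2 * p + 1) := by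
            gcongr
            exact hfloor.trans
              (Real.rpow_le_rpow (by positivity) (by linarith) (by positivity))
        _ = _ := by
            rw [← Real.rpow_mul hl]
            congr 1
            ring
    calc _ ≤ (n : ℝ) ^ (1 / 2 : ℝ) * (n : ℝ) ^ (1 / 2 : ℝ) := by gcongr
      _ = n := by rw [← Real.rpow_add hn']; norm_num

theorem proposition4p4 (p : ℝ) (s : ℕ) (hsp : (s : ℝ) ≤ p)
    (ρ σ d η : ℝ) (hρ : 0 < ρ) (hσ : 0 < σ) (hd : 1 ≤ d) (hη : 1 ≤ η) :
    -- the derivatives in the risk exist and are unique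
    (∀ f : L2I, sobolevNormSq p f < ∞ → ∃! g : L2I, IsWeakDeriv s f g) ∧
    (∀ (n m : ℕ) (α : ℝ) (x : Fin n → L2I) (y : Fin n → ℝ),
      ∃! g : L2I, IsWeakDeriv s (seriesEstimator m α x y) g) ∧
    -- polynomial case
    (∀ a : ℝ, 1 / 2 < a → ∀ (m : ℕ → ℕ) (α : ℕ → ℝ),
      RateEq (fun n => (m n : ℝ)) (fun n => (n : ℝ) ^ (1 / (2 * p + 2 * a + 1))) →
      RateEq α (fun n => 1 / (n : ℝ)) →
      HasUpperRate.{u} (polyWeight a) p s ρ σ d η m α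
        (fun n => (n : ℝ) ^ (-(2 * p - 2 * s) / (2 * p + 2 * a + 1)))) ∧
    -- exponential case
    (∀ a : ℝ, 0 < a →
      (∃ m : ℕ → ℕ,
        RateEq (fun n => (m n : ℝ)) (fun n => Real.log n ^ (1 / (2 * a))) ∧
        VarianceBalanced (expWeight a) p s m) ∧
      ∀ (m : ℕ → ℕ) (α : ℕ → ℝ),
        RateEq (fun n => (m n : ℝ)) (fun n => Real.log n ^ (1 / (2 * a))) →
        VarianceBalanced (expWeight a) p s m →
        RateEq α (fun n => 1 / (n : ℝ)) →
        HasUpperRate.{u} (expWeight a) p s ρ σ d η m α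
          (fun n => Real.log n ^ (-(p - s) / a))) := by

  have hp : 0 ≤ p := (Nat.cast_nonneg s).trans hsp
  have hex : ∀ f : L2I, sobolevNormSq s f < ∞ → ∃! g : L2I, IsWeakDeriv s f g := by
    intro f hf
    obtain ⟨g, hg, -⟩ := exists_isWeakDeriv s hf
    exact ⟨g, hg, fun g' hg' => hg'.unique hg⟩
  refine ⟨fun f hf => hex f ((sobolevNormSq_mono hsp f).trans_lt hf),
    fun n m α x y => hex _ (sobolevNormSq_seriesEstimator_lt_top _ _ _ _ _), ?_, ?_⟩
  · intro a ha m α hm hα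
    have hD : 0 < 2 * p + 2 * a + 1 := by linarith
    have hb : ∀ᶠ n : ℕ in atTop, 0 < (n : ℝ) ^ (1 / (2 * p + 2 * a + 1)) := by
      filter_upwards [eventually_gt_atTop 0] with n hn
      positivity
    refine hasUpperRate_of_varianceBalanced hsp hρ hd hη (fun j hj => polyWeight_pos a hj)
      (fun j hj => polyWeight_le_one (by linarith) hj) (by simp [polyWeight])
      (summable_polyWeight ha) hb hm.2 (Eventually.of_forall fun n => ?_)
      (varianceBalanced_polyWeight hp (by linarith)
        (eventually_sobolevWeight_ratio_le hsp hb hm.2).1 hm.1) hα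
    rw [← Real.rpow_mul (Nat.cast_nonneg n)]
    congr 1
    field_simp
  · intro a ha
    refine ⟨exists_varianceBalanced_expWeight s hp ha, fun m α hm hbal hα => ?_⟩
    have hlog : Tendsto (fun n : ℕ => Real.log n) atTop atTop :=
      Real.tendsto_log_atTop.comp tendsto_natCast_atTop_atTop
    have hb : ∀ᶠ n : ℕ in atTop, 0 < Real.log n ^ (1 / (2 * a)) := by
      filter_upwards [hlog.eventually_gt_atTop 0] with n hn
      positivity
    refine hasUpperRate_of_varianceBalanced hsp hρ hd hη (fun j _ => expWeight_pos a j)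
      (fun j _ => expWeight_le_one a j) (by simp [expWeight])
      (summable_expWeight ha) hb hm.2 ?_ hbal hα
    filter_upwards [hlog.eventually_ge_atTop 0] with n hn
    rw [← Real.rpow_mul hn]
    congr 1
    field_simp
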